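/- An $r$-graph is a finite $r$-uniform hypergraph $H$ without repeated edges; $H$ is linear if any two distinct edges share at most one vertex. A $k$-cut of $H$ is a partition of the vertex set into $k$ parts, together with all edges having at least one vertex in each part; $\mathrm{mc}_k(H)$ is the maximum number of edges in a $k$-cut. For an $r$-graph $H$ with $m$ edges, put $$\mathrm{surp}_k(H)=\mathrm{mc}_k(H)-\frac{S(r,k)\,k!}{k^r}\,m,$$ where $S(r,k)$ is the Stirling number of the second kind. **Theorem 1.4.** For every integer $r\ge 4$ there is a constant $c>0$, depending only on $r$, such that for each $k\in\{r-1,r\}$ and every $r$-graph $H$ with $m\ge 2$ edges, $$\mathrm{surp}_k(H)\ \ge\ c\,\frac{m^{3/5}}{(\log m)^2}.$$ Moreover, if $H$ is linear, then $$\mathrm{surp}_k(H)\ \ge\ c\,\frac{m^{3/4}}{(\log m)^2}.$$ -/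

import Mathlib

namespace Hypergraph

/-- `H` is an `r`-graph: every edge has exactly `r` vertices. Mathlib's hypergraphs have a set of
edges, so there are no repeated edges. -/
def IsUniform {α : Type*} (H : Hypergraph α) (r : ℕ) : Prop :=
  ∀ e ∈ H.edgeSet, e.encard = (r : ℕ∞)

/-- `H` is linear: any two distinct edges have at most one vertex in common. -/
def IsLinear {α : Type*} (H : Hypergraph α) : Prop :=
  ∀ e ∈ H.edgeSet, ∀ f ∈ H.edgeSet, e ≠ f → (e ∩ f).encard ≤ 1

/-- The edges of the `k`-cut given by `P`. A map `P : α → Fin k` encodes the partition of the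
vertex set into the parts `V_i = {v ∈ V(H) | P v = i}`; as edges lie inside `V(H)`, the values of
`P` elsewhere are irrelevant. An edge is cut if it has at least one vertex in each part, so a
partition with an empty part cuts no edge. -/
def cutEdges {α : Type*} (H : Hypergraph α) {k : ℕ} (P : α → Fin k) : Set (Set α) :=
  {e ∈ H.edgeSet | ∀ i : Fin k, ∃ v ∈ e, P v = i}

/-- The Max-`k`-Cut: the largest number of edges in a `k`-cut. -/
noncomputable def maxCut {α : Type*} (H : Hypergraph α) (k : ℕ) : ℕ :=
  sSup (Set.range fun P : α → Fin k => (H.cutEdges P).ncard)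

/-- The supremum defining `maxCut` is an attained maximum. -/
theorem isGreatest_maxCut {α : Type*} (H : Hypergraph α) (hE : H.edgeSet.Finite) (k : ℕ)
    [NeZero k] :
    IsGreatest (Set.range fun P : α → Fin k => (H.cutEdges P).ncard) (H.maxCut k) := by
  have hb : BddAbove (Set.range fun P : α → Fin k => (H.cutEdges P).ncard) := by
    refine ⟨H.edgeSet.ncard, ?_⟩
    rintro _ ⟨P, rfl⟩
    exact Set.ncard_le_ncard (fun e he => he.1) hE
  exact ⟨Nat.sSup_mem ⟨_, fun _ => 0, rfl⟩ hb, fun _ h => le_csSup hb h⟩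

/-- The `k`-surplus of an `r`-graph: the size of a maximum `k`-cut minus the expected size
`(S(r,k) k! / k ^ r) * e(H)` of a uniformly random `k`-cut. -/
noncomputable def surplus {α : Type*} (H : Hypergraph α) (r k : ℕ) : ℝ :=
  (H.maxCut k : ℝ) -
    ((Nat.stirlingSecond r k : ℝ) * (Nat.factorial k : ℝ) / (k : ℝ) ^ r) *
      (H.edgeSet.ncard : ℝ)

end Hypergraph

open Finset BigOperators

set_option linter.unusedSectionVars false

namespace Hypergraph

/-! Draw a uniform random `P : V → Fin k` and let the vertices in the first two parts be free to
choose again between these two parts. An edge can still become cut only if it hits the other `k - 2`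
parts, and since `r ≤ k + 1` it then has at most three free vertices. For two or three signs, "not
all equal" is a quadratic polynomial, so the number of cut edges is a constant minus the quadratic
form of a weighted graph `freeWeight` (`cutCount_reassign`). The constant has mean equal to the
random-cut value (`expect_freeMean`), so surplus amounts to finding good Max-Cuts in these random
weighted graphs.

Such cuts come from semidefinite rounding (`exists_sign_le_of_posSemidef`): if `M` has zero diagonal
and `1 - M` is positive semidefinite, rounding a subgaussian vector with covariance `1 - M` gains
about `⟨freeWeight, M⟩ / log m`. Averaging over `P` gives `expect_test_le_surplus`, where `M` may
depend on `P`.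

Two kinds of test matrix are used. A graph of maximum degree `ρ`, scaled by `1 / ρ`, gains about `1
/ ρ` from each edge containing an adjacent pair (`surplus_of_pairs`). For a triple system, `M P` is
the sum of the link matrices of the vertices `v`, weighted by a centred function of `P v`. It
correlates with `freeWeight`, because moving `v` out of the free parts never lowers the weight of a
pair in a common edge. By a matrix Khintchine inequality (`expect_trace_pow_le`) its largest
eigenvalue is typically only `√(D₁ D₂ log m)` (`surplus_of_triples`).

Finally, as `r ≥ 4`, every edge contains a bad pair (two heavy vertices, or two light ones of large
codegree) or a good triple (`card_le_badPair_add_goodTriple`). With thresholds `m ^ (3/5)` for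
degrees and `m ^ (1/5)` for codegrees, both cases lose a factor `m ^ (2/5)` up to logarithms. In a
linear hypergraph the codegree threshold is 1 and the degree threshold is of order `√m`; bad pairs
are then rare and good triples lose only `m ^ (1/4)`. -/

/-! ### Random signs and rounding of positive semidefinite matrices. -/

/-- The real sign of a Boolean. -/
def sgn (b : Bool) : ℝ := if b then 1 else -1

theorem sgn_not (b : Bool) : sgn (!b) = -sgn b := by cases b <;> simp [sgn]

theorem sgn_mul_self (b : Bool) : sgn b * sgn b = 1 := by cases b <;> simp [sgn]

theorem expect_nonneg' {ι : Type*} [Fintype ι] {f : ι → ℝ} (h : ∀ i, 0 ≤ f i) : 0 ≤ 𝔼 i, f i :=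
  Finset.expect_nonneg fun i _ => h i

theorem expect_mono {ι : Type*} [Fintype ι] {f g : ι → ℝ} (h : ∀ i, f i ≤ g i) :
    𝔼 i, f i ≤ 𝔼 i, g i :=
  Finset.expect_le_expect fun i _ => h i

theorem expect_sgn_mul_sgn {J : Type*} [Fintype J] [DecidableEq J] {i j : J} (hij : i ≠ j) :
    𝔼 ε : J → Bool, sgn (ε i) * sgn (ε j) = 0 := by
  have h : 𝔼 ε : J → Bool, sgn (ε i) * sgn (ε j) =
      𝔼 ε : J → Bool, -(sgn (ε i) * sgn (ε j)) := by
    have hinv : Function.Involutive fun ε : J → Bool => Function.update ε i (!(ε i)) := by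
      intro ε
      ext v
      by_cases hv : v = i
      · subst hv; simp
      · simp [hv]
    refine Fintype.expect_equiv hinv.toPerm _ _ fun ε => ?_
    simp [Function.Involutive.toPerm, hij.symm, sgn_not]
  rw [Finset.expect_neg_distrib] at h
  linarith

theorem expect_linear_mul_linear {J : Type*} [Fintype J] [DecidableEq J] (a b : J → ℝ) :
    𝔼 ε : J → Bool, (∑ j, a j * sgn (ε j)) * (∑ j, b j * sgn (ε j)) = ∑ j, a j * b j := by
  have h1 : ∀ ε : J → Bool, (∑ j, a j * sgn (ε j)) * (∑ j, b j * sgn (ε j)) =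
      ∑ i, ∑ j, (a i * b j) * (sgn (ε i) * sgn (ε j)) := by
    intro ε
    rw [Finset.sum_mul_sum]
    exact sum_congr rfl fun i _ => sum_congr rfl fun j _ => by ring
  simp_rw [h1]
  rw [Finset.expect_sum_comm]
  refine sum_congr rfl fun i _ => ?_
  rw [Finset.expect_sum_comm, Finset.sum_eq_single i]
  · rw [← Finset.mul_expect]
    simp [sgn_mul_self]
  · intro j _ hj
    rw [← Finset.mul_expect, expect_sgn_mul_sgn hj.symm, mul_zero]
  · simp

/-- The exponential moment factors over the independent signs into `cosh (a j)`, and `cosh x ≤ exp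
(x ^ 2 / 2)`. -/
theorem expect_exp_linear_le {J : Type*} [Fintype J] [DecidableEq J] (a : J → ℝ) :
    𝔼 ε : J → Bool, Real.exp (∑ j, a j * sgn (ε j)) ≤ Real.exp ((∑ j, a j ^ 2) / 2) := by
  have h1 : ∑ ε : J → Bool, Real.exp (∑ j, a j * sgn (ε j)) =
      ∏ j, ∑ b : Bool, Real.exp (a j * sgn b) := by
    rw [Fintype.prod_sum]
    exact sum_congr rfl fun ε _ => Real.exp_sum _ _
  have h2 : ∀ j, ∑ b : Bool, Real.exp (a j * sgn b) = 2 * Real.cosh (a j) := by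
    intro j
    rw [Real.cosh_eq]
    simp [sgn]
    ring
  rw [Fintype.expect_eq_sum_div_card, h1]
  simp_rw [h2]
  rw [prod_mul_distrib, prod_const]
  have h3 : ((Fintype.card (J → Bool) : ℕ) : ℝ) = 2 ^ (#(univ : Finset J)) := by simp
  rw [h3, mul_div_cancel_left₀ _ (by positivity), Finset.sum_div, Real.exp_sum]
  exact prod_le_prod (fun j _ => (Real.cosh_pos _).le) fun j _ => Real.cosh_le_exp_half_sq _

/-- Truncation of a real number to `[-T, T]`. -/
noncomputable def trunc (T x : ℝ) : ℝ := max (-T) (min T x)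

theorem abs_trunc_le {T : ℝ} (hT : 0 ≤ T) (x : ℝ) : |trunc T x| ≤ T := by
  rw [abs_le, trunc]
  exact ⟨le_max_left _ _, max_le (by linarith) (min_le_left _ _)⟩

theorem abs_trunc_le_abs {T : ℝ} (hT : 0 ≤ T) (x : ℝ) : |trunc T x| ≤ |x| := by
  unfold trunc
  rcases le_total T x with h | h
  · rw [min_eq_left h, max_eq_right (by linarith)]
    exact abs_le_abs_of_nonneg hT h
  · rw [min_eq_right h]
    rcases le_total (-T) x with h' | h'
    · rw [max_eq_right h']
    · rw [max_eq_left h', abs_neg, abs_of_nonneg hT, abs_of_nonpos (by linarith)]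
      linarith

/-- The excess `s = |x| - T`, when nonnegative, satisfies `s ^ 2 ≤ 2 exp (T s) / T ^ 2`. This turns
exponential moments into an `L²` bound on the truncation error. -/
theorem sq_sub_trunc_le {T : ℝ} (hT : 0 < T) (x : ℝ) :
    (x - trunc T x) ^ 2 ≤
      2 * Real.exp (-T ^ 2) / T ^ 2 * (Real.exp (T * x) + Real.exp (-(T * x))) := by
  have key : ∀ s : ℝ, 0 ≤ s → s ^ 2 ≤ 2 * Real.exp (-T ^ 2) / T ^ 2 * Real.exp (T * (s + T)) := by
    intro s hs
    have h := Real.quadratic_le_exp_of_nonneg (mul_nonneg hT.le hs)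
    have h2 : 2 * Real.exp (-T ^ 2) / T ^ 2 * Real.exp (T * (s + T)) =
        2 * Real.exp (T * s) / T ^ 2 := by
      rw [div_mul_eq_mul_div, mul_assoc, ← Real.exp_add]
      congr 3
      ring
    rw [h2, le_div_iff₀ (by positivity)]
    nlinarith [mul_nonneg hT.le hs]
  have hc : 0 ≤ 2 * Real.exp (-T ^ 2) / T ^ 2 := by positivity
  unfold trunc
  rcases le_total T x with h | h
  · rw [min_eq_left h, max_eq_right (by linarith)]
    have := key (x - T) (by linarith)
    rw [sub_add_cancel] at this
    refine this.trans (mul_le_mul_of_nonneg_left ?_ hc)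
    linarith [Real.exp_pos (-(T * x))]
  · rw [min_eq_right h]
    rcases le_total (-T) x with h' | h'
    · rw [max_eq_right h', sub_self, zero_pow two_ne_zero]
      exact mul_nonneg hc (by positivity)
    · rw [max_eq_left h']
      have := key (-x - T) (by linarith)
      rw [sub_add_cancel] at this
      calc (x - -T) ^ 2 = (-x - T) ^ 2 := by ring
        _ ≤ _ := this
        _ ≤ _ := by
          refine mul_le_mul_of_nonneg_left ?_ hc
          rw [mul_neg]
          linarith [Real.exp_pos (T * x)]

/-- The two factors are replaced one at a time, and each cross term is split by the weighted
inequality between arithmetic and geometric means. The parameter `θ` balances variance against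
truncation error. -/
theorem trunc_mul_trunc_le {T θ : ℝ} (hT : 0 ≤ T) (hθ : 0 < θ) (x y : ℝ) :
    trunc T x * trunc T y ≤ x * y + (θ * x ^ 2 + θ * y ^ 2) / 2 +
      ((x - trunc T x) ^ 2 + (y - trunc T y) ^ 2) / (2 * θ) := by
  have h1 : trunc T x * trunc T y - x * y ≤
      |x| * |y - trunc T y| + |y| * |x - trunc T x| := by
    calc trunc T x * trunc T y - x * y
        = -(trunc T x * (y - trunc T y)) - y * (x - trunc T x) := by ring
      _ ≤ |trunc T x * (y - trunc T y)| + |y * (x - trunc T x)| := by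
        have a1 := neg_le_abs (trunc T x * (y - trunc T y))
        have a2 := neg_le_abs (y * (x - trunc T x))
        linarith
      _ ≤ _ := by
        rw [abs_mul, abs_mul]
        have := mul_le_mul_of_nonneg_right (abs_trunc_le_abs hT x) (abs_nonneg (y - trunc T y))
        linarith
  have h2 : ∀ a b : ℝ, |a| * |b| ≤ θ * a ^ 2 / 2 + b ^ 2 / (2 * θ) := by
    intro a b
    rw [← sq_abs a, ← sq_abs b]
    have : θ * |a| ^ 2 / 2 + |b| ^ 2 / (2 * θ) - |a| * |b| = (θ * |a| - |b|) ^ 2 / (2 * θ) := by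
      field_simp
      ring
    have h3 : 0 ≤ (θ * |a| - |b|) ^ 2 / (2 * θ) := by positivity
    linarith
  have h3 := h2 x (y - trunc T y)
  have h4 := h2 y (x - trunc T x)
  rw [add_div]
  rw [add_div]
  linarith

/-- A quadratic form with zero diagonal attains its minimum over a cube at a vertex. -/
theorem exists_sign_le {V : Type*} [Fintype V] [DecidableEq V] (A : V → V → ℝ)
    (hA : ∀ u, A u u = 0) (t : V → ℝ) (ht : ∀ u, |t u| ≤ 1) :
    ∃ y : V → Bool, ∑ u, ∑ x, A u x * (sgn (y u) * sgn (y x)) ≤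
      ∑ u, ∑ x, A u x * (t u * t x) := by
  have key : ∀ S : Finset V, ∃ z : V → ℝ, (∀ u ∈ S, z u = 1 ∨ z u = -1) ∧ (∀ u ∉ S, z u = t u) ∧
      ∑ u, ∑ x, A u x * (z u * z x) ≤ ∑ u, ∑ x, A u x * (t u * t x) := by
    intro S
    induction S using Finset.induction_on with
    | empty => exact ⟨t, by simp, by simp, le_rfl⟩
    | insert v S hv ih =>
      obtain ⟨z, hz1, hz2, hz3⟩ := ih
      have hzv : |z v| ≤ 1 := by rw [hz2 v hv]; exact ht v
      obtain ⟨hl, hu⟩ := abs_le.1 hzv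
      set Q : (V → ℝ) → ℝ := fun z => ∑ u, ∑ x, A u x * (z u * z x) with hQ
      -- The zero diagonal makes `Q` affine in each single coordinate.
      have hconv : Q z = (1 + z v) / 2 * Q (Function.update z v 1) +
          (1 - z v) / 2 * Q (Function.update z v (-1)) := by
        simp only [hQ, mul_sum]
        rw [← sum_add_distrib]
        refine sum_congr rfl fun u _ => ?_
        rw [← sum_add_distrib]
        refine sum_congr rfl fun x _ => ?_
        by_cases h1 : u = v
        · subst h1
          by_cases h2 : x = u
          · subst h2; simp [hA]
          · simp [h2]; ring
        · by_cases h2 : x = v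
          · subst h2; simp [h1]; ring
          · simp [h1, h2]; ring
      have hex : ∃ c : ℝ, (c = 1 ∨ c = -1) ∧ Q (Function.update z v c) ≤ Q z := by
        by_contra hcon
        push Not at hcon
        have h1 := hcon 1 (Or.inl rfl)
        have h2 := hcon (-1) (Or.inr rfl)
        rcases lt_or_ge (z v) 0 with h | h <;> nlinarith
      obtain ⟨c, hc, hcQ⟩ := hex
      refine ⟨Function.update z v c, ?_, ?_, hcQ.trans hz3⟩
      · intro u hu
        by_cases h1 : u = v
        · subst h1; simpa using hc
        · simp only [ne_eq, h1, not_false_eq_true, Function.update_of_ne]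
          exact hz1 u ((mem_insert.1 hu).resolve_left h1)
      · intro u hu
        rw [mem_insert, not_or] at hu
        rw [Function.update_of_ne hu.1]
        exact hz2 u hu.2
  obtain ⟨z, hz1, -, hz3⟩ := key univ
  refine ⟨fun u => decide (z u = 1), ?_⟩
  have : ∀ u, sgn (decide (z u = 1)) = z u := by
    intro u
    rcases hz1 u (mem_univ u) with h | h
    · simp [h, sgn]
    · rw [h]; norm_num [sgn]
  simpa only [this] using hz3

/-- Rounding a positive semidefinite matrix with unit diagonal to signs. -/
theorem exists_sign_le_of_posSemidef {V : Type*} [Fintype V] [DecidableEq V] (A : V → V → ℝ)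
    (hA : ∀ u, A u u = 0) (hA0 : ∀ u x, 0 ≤ A u x) (K : Matrix V V ℝ) (hK : K.PosSemidef)
    (hK1 : ∀ u, K u u = 1) {T : ℝ} (hT : 2 ≤ T) :
    ∃ y : V → Bool, ∑ u, ∑ x, A u x * (sgn (y u) * sgn (y x)) ≤
      1 / T ^ 2 * (∑ u, ∑ x, A u x * K u x +
        2 * Real.exp (-T ^ 2 / 4) * ∑ u, ∑ x, A u x) := by
  have hT0 : 0 < T := by linarith
  -- A Gram factorisation of `K` yields the signed sums `X`, which have covariance `K` and are
  -- subgaussian of unit variance.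
  obtain ⟨m, a, ha⟩ := Matrix.posSemidef_iff_eq_sum_vecMulVec.mp hK
  have hKa : ∀ u x, K u x = ∑ j, a j u * a j x := by
    intro u x
    rw [ha, Matrix.sum_apply]
    simp [Matrix.vecMulVec_apply]
  set X : (Fin m → Bool) → V → ℝ := fun ε u => ∑ j, a j u * sgn (ε j) with hX
  have hcov : ∀ u x, 𝔼 ε, X ε u * X ε x = K u x := by
    intro u x
    rw [hKa]
    exact expect_linear_mul_linear _ _
  have hvar : ∀ u, 𝔼 ε, X ε u ^ 2 = 1 := by
    intro u
    rw [← hK1 u, ← hcov]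
    simp_rw [sq]
  have hexp : ∀ (l : ℝ) (u : V), l ^ 2 = T ^ 2 →
      𝔼 ε, Real.exp (l * X ε u) ≤ Real.exp (T ^ 2 / 2) := by
    intro l u hl
    have h := expect_exp_linear_le (fun j => l * a j u)
    have h2 : ∑ j, (l * a j u) ^ 2 = T ^ 2 := by
      simp_rw [mul_pow, ← mul_sum, hl]
      have := hKa u u
      rw [hK1] at this
      simp_rw [sq (a _ u)]
      rw [← this, mul_one]
    rw [h2] at h
    refine le_trans (le_of_eq ?_) h
    refine Finset.expect_congr rfl fun ε _ => ?_
    simp only [hX, mul_sum, mul_assoc]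
  have htail : ∀ u, 𝔼 ε, (X ε u - trunc T (X ε u)) ^ 2 ≤ Real.exp (-T ^ 2 / 2) := by
    intro u
    have h1 : 𝔼 ε, (X ε u - trunc T (X ε u)) ^ 2 ≤
        𝔼 ε, 2 * Real.exp (-T ^ 2) / T ^ 2 *
          (Real.exp (T * X ε u) + Real.exp (-T * X ε u)) := by
      refine expect_mono fun ε => ?_
      rw [neg_mul]
      exact sq_sub_trunc_le hT0 _
    rw [← Finset.mul_expect, Finset.expect_add_distrib] at h1
    have h2 := hexp T u rfl
    have h3 := hexp (-T) u (by ring)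
    have hc : 0 ≤ 2 * Real.exp (-T ^ 2) / T ^ 2 := by positivity
    refine h1.trans ((mul_le_mul_of_nonneg_left (add_le_add h2 h3) hc).trans ?_)
    have h4 : 2 * Real.exp (-T ^ 2) / T ^ 2 * (Real.exp (T ^ 2 / 2) + Real.exp (T ^ 2 / 2)) =
        4 / T ^ 2 * Real.exp (-T ^ 2 / 2) := by
      have : Real.exp (-T ^ 2 / 2) = Real.exp (-T ^ 2) * Real.exp (T ^ 2 / 2) := by
        rw [← Real.exp_add]; congr 1; ring
      rw [this]; ring
    rw [h4]
    have h5 : 4 / T ^ 2 ≤ 1 := by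
      rw [div_le_one (by positivity)]; nlinarith
    nlinarith [Real.exp_pos (-T ^ 2 / 2)]
  -- `θ` is the square root of the tail bound, so the variance term and the truncation term each
  -- cost `θ`.
  set θ := Real.exp (-T ^ 2 / 4) with hθ
  have hθ0 : 0 < θ := Real.exp_pos _
  have hθ2 : Real.exp (-T ^ 2 / 2) = θ * θ := by
    rw [hθ, ← Real.exp_add]; congr 1; ring
  have hpair : ∀ u x, 𝔼 ε, trunc T (X ε u) * trunc T (X ε x) ≤ K u x + 2 * θ := by
    intro u x
    have h1 : 𝔼 ε, trunc T (X ε u) * trunc T (X ε x) ≤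
        𝔼 ε, (X ε u * X ε x + (θ * X ε u ^ 2 + θ * X ε x ^ 2) / 2 +
          ((X ε u - trunc T (X ε u)) ^ 2 + (X ε x - trunc T (X ε x)) ^ 2) / (2 * θ)) :=
      expect_mono fun ε => trunc_mul_trunc_le hT0.le hθ0 _ _
    rw [Finset.expect_add_distrib, Finset.expect_add_distrib, ← Finset.expect_div,
      ← Finset.expect_div, Finset.expect_add_distrib, Finset.expect_add_distrib,
      ← Finset.mul_expect, ← Finset.mul_expect, hcov, hvar, hvar] at h1
    have h2 := htail u
    have h3 := htail x
    rw [hθ2] at h2 h3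
    have h4 : (𝔼 ε, (X ε u - trunc T (X ε u)) ^ 2 + 𝔼 ε, (X ε x - trunc T (X ε x)) ^ 2) / (2 * θ)
        ≤ θ := by
      rw [div_le_iff₀ (by positivity)]
      nlinarith
    linarith
  have htot : 𝔼 ε, ∑ u, ∑ x, A u x * (trunc T (X ε u) * trunc T (X ε x)) ≤
      ∑ u, ∑ x, A u x * K u x + 2 * θ * ∑ u, ∑ x, A u x := by
    simp_rw [Finset.expect_sum_comm, ← Finset.mul_expect, mul_sum, ← sum_add_distrib]
    refine sum_le_sum fun u _ => sum_le_sum fun x _ => ?_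
    have := mul_le_mul_of_nonneg_left (hpair u x) (hA0 u x)
    linarith
  obtain ⟨ε, -, hε⟩ := Finset.exists_le_of_expect_le (s := (univ : Finset (Fin m → Bool)))
    univ_nonempty htot
  -- Scaling the truncated values into the cube is what costs the factor `1 / T ^ 2`.
  obtain ⟨y, hy⟩ := exists_sign_le A hA (fun u => trunc T (X ε u) / T) (fun u => by
    rw [abs_div, abs_of_pos hT0, div_le_one hT0]
    exact abs_trunc_le hT0.le _)
  refine ⟨y, hy.trans ?_⟩
  have : ∑ u, ∑ x, A u x * (trunc T (X ε u) / T * (trunc T (X ε x) / T)) =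
      1 / T ^ 2 * ∑ u, ∑ x, A u x * (trunc T (X ε u) * trunc T (X ε x)) := by
    simp_rw [mul_sum]
    refine sum_congr rfl fun u _ => sum_congr rfl fun x _ => ?_
    field_simp
  rw [this]
  exact mul_le_mul_of_nonneg_left hε (by positivity)

/-- The number of surjections from an `n`-element type onto `Fin k` is `S(n, k) k!`. -/
theorem card_surjective_fin (n k : ℕ) :
    #{f : Fin n → Fin k | Function.Surjective f} = n.stirlingSecond k * k.factorial := by
  induction n generalizing k with
  | zero =>
    cases k with
    | zero => simp [Function.Surjective]
    | succ k => simp [Function.Surjective]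
  | succ n ih =>
    cases k with
    | zero => simp
    | succ k =>
      have h1 : ∀ (j : Fin (k + 1)) (g : Fin n → Fin (k + 1)),
          Function.Surjective (Fin.cons j g : Fin (n + 1) → Fin (k + 1)) ↔
            ∀ i, i ≠ j → ∃ a, g a = i := by
        intro j g
        constructor
        · intro h i hi
          obtain ⟨a, ha⟩ := h i
          cases a using Fin.cases with
          | zero => exact absurd (by simpa using ha.symm) hi
          | succ a => exact ⟨a, by simpa using ha⟩
        · intro h i
          by_cases hi : i = j
          · exact ⟨0, by simp [hi]⟩
          · obtain ⟨a, ha⟩ := h i hi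
            exact ⟨a.succ, by simpa using ha⟩
      have h2 : ∀ j : Fin (k + 1),
          #{g : Fin n → Fin (k + 1) | ∀ i, i ≠ j → ∃ a, g a = i} =
            n.stirlingSecond (k + 1) * (k + 1).factorial + n.stirlingSecond k * k.factorial := by
        intro j
        rw [← ih, ← ih, ← card_filter_add_card_filter_not (p := fun g => ∃ a, g a = j),
          filter_filter, filter_filter]
        congr 1
        · congr 1
          refine filter_congr fun g _ => ⟨fun h i => ?_, fun h => ⟨fun i _ => h i, h j⟩⟩
          by_cases hi : i = j
          · rw [hi]; exact h.2
          · exact h.1 i hi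
        · symm
          -- Functions missing exactly `j` are surjections onto the `k` remaining values, relabelled
          -- by `succAbove`.
          refine card_bij (fun h _ => fun a => j.succAbove (h a)) ?_ ?_ ?_
          · intro h hh
            simp only [mem_filter, mem_univ, true_and] at hh ⊢
            refine ⟨fun i hi => ?_, ?_⟩
            · obtain ⟨b, rfl⟩ := Fin.exists_succAbove_eq hi
              obtain ⟨a, rfl⟩ := hh b
              exact ⟨a, rfl⟩
            · rintro ⟨a, ha⟩
              exact Fin.succAbove_ne _ _ ha
          · intro h _ h' _ hh
            funext a
            exact Fin.succAbove_right_injective (congrFun hh a)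
          · intro g hg
            simp only [mem_filter, mem_univ, true_and, not_exists] at hg
            choose f hf using fun a => Fin.exists_succAbove_eq (hg.2 a)
            refine ⟨f, ?_, funext hf⟩
            simp only [mem_filter, mem_univ, true_and]
            intro b
            obtain ⟨a, ha⟩ := hg.1 (j.succAbove b) (Fin.succAbove_ne _ _)
            refine ⟨a, Fin.succAbove_right_injective (p := j) ?_⟩
            rw [hf, ha]
      have h3 : #{f : Fin (n + 1) → Fin (k + 1) | Function.Surjective f} =
          ∑ j : Fin (k + 1), #{g : Fin n → Fin (k + 1) | ∀ i, i ≠ j → ∃ a, g a = i} := by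
        simp only [card_filter]
        rw [← Fintype.sum_prod_type']
        refine (Fintype.sum_equiv (Fin.consEquiv fun _ => Fin (k + 1)) _ _ fun p => ?_).symm
        exact if_congr (h1 p.1 p.2).symm rfl rfl
      rw [h3, sum_congr rfl fun j _ => h2 j, sum_const, card_univ, Fintype.card_fin,
        Nat.stirlingSecond_succ_succ, Nat.factorial_succ, smul_eq_mul]
      ring

/-! ### Cuts as quadratic forms in the free vertices. -/

section Cut

variable {V : Type*} [Fintype V] [DecidableEq V] {k : ℕ}

/-- `P` hits every part on the finset `e`. -/
def IsCut (P : V → Fin k) (e : Finset V) : Prop := ∀ i, ∃ v ∈ e, P v = i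

instance (P : V → Fin k) (e : Finset V) : Decidable (IsCut P e) :=
  inferInstanceAs (Decidable (∀ i, ∃ v ∈ e, P v = i))

/-- The number of edges cut by `P`. -/
def cutCount (E : Finset (Finset V)) (P : V → Fin k) : ℕ := #{e ∈ E | IsCut P e}

theorem expect_restrict [NeZero k] (e : Finset V) (G : (e → Fin k) → ℝ) :
    𝔼 P : V → Fin k, G (fun v => P v) = 𝔼 Q : e → Fin k, G Q := by
  rw [Fintype.expect_equiv (Equiv.piEquivPiSubtypeProd (fun v => v ∈ e) fun _ => Fin k)
    (fun P : V → Fin k => G fun v => P v) (fun p => G p.1) (fun P => rfl),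
    ← Finset.univ_product_univ, Finset.expect_product]
  exact Finset.expect_congr rfl fun Q _ => Fintype.expect_const (ι := {v // v ∉ e} → Fin k) (G Q)

theorem expect_isCut (e : Finset V) [NeZero k] :
    𝔼 P : V → Fin k, (if IsCut P e then (1 : ℝ) else 0) =
      ((#e).stirlingSecond k : ℝ) * k.factorial / (k : ℝ) ^ #e := by
  have h1 : ∀ P : V → Fin k, IsCut P e ↔ Function.Surjective fun v : e => P v := by
    intro P
    simp [IsCut, Function.Surjective]
  simp_rw [h1]
  rw [expect_restrict e fun Q : e → Fin k => if Function.Surjective Q then (1 : ℝ) else 0]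
  have h2 : 𝔼 Q : e → Fin k, (if Function.Surjective Q then (1 : ℝ) else 0) =
      𝔼 f : Fin #e → Fin k, (if Function.Surjective f then (1 : ℝ) else 0) := by
    refine Fintype.expect_equiv (Equiv.arrowCongr e.equivFin (Equiv.refl _)) _ _ fun Q => ?_
    refine if_congr ?_ rfl rfl
    simp [Equiv.arrowCongr]
  rw [h2, Fintype.expect_eq_sum_div_card, sum_boole, card_surjective_fin]
  simp

/-- The vertices of `e` in the first two parts. -/
def lowPart (P : V → Fin k) (e : Finset V) : Finset V := {v ∈ e | (P v).val < 2}

/-- Every part other than the first two is hit by `e`. -/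
def IsHit (P : V → Fin k) (e : Finset V) : Prop := ∀ i : Fin k, 2 ≤ i.val → ∃ v ∈ e, P v = i

instance (P : V → Fin k) (e : Finset V) : Decidable (IsHit P e) :=
  inferInstanceAs (Decidable (∀ i : Fin k, 2 ≤ i.val → ∃ v ∈ e, P v = i))

/-- Weight of an ordered pair inside the free part of an edge with `b` free vertices. -/
noncomputable def pairWeight (b : ℕ) : ℝ := if b = 2 then 1 / 4 else if b = 3 then 1 / 8 else 0

/-- Cutting probability of an edge with `b` free vertices. -/
noncomputable def cutProb (b : ℕ) : ℝ := if b = 2 then 1 / 2 else if b = 3 then 3 / 4 else 0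

/-- The contribution of the edge `e` to the weighted graph on the free vertices. -/
noncomputable def edgeWeight (P : V → Fin k) (e : Finset V) (u x : V) : ℝ :=
  if u ≠ x ∧ u ∈ lowPart P e ∧ x ∈ lowPart P e ∧ IsHit P e then pairWeight #(lowPart P e) else 0

/-- The weighted graph on the free vertices. -/
noncomputable def freeWeight (E : Finset (Finset V)) (P : V → Fin k) (u x : V) : ℝ :=
  ∑ e ∈ E, edgeWeight P e u x

/-- The expected number of cut edges when the free vertices are reassigned at random. -/
noncomputable def freeMean (E : Finset (Finset V)) (P : V → Fin k) : ℝ :=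
  ∑ e ∈ E, if IsHit P e then cutProb #(lowPart P e) else 0

/-- Reassign the free vertices to the first two parts according to `y`. -/
def reassign (hk : 3 ≤ k) (P : V → Fin k) (y : V → Bool) (v : V) : Fin k :=
  if (P v).val < 2 then (if y v then ⟨0, by omega⟩ else ⟨1, by omega⟩) else P v

theorem isCut_reassign (hk : 3 ≤ k) (P : V → Fin k) (y : V → Bool) (e : Finset V) :
    IsCut (reassign hk P y) e ↔ IsHit P e ∧ (∃ v ∈ lowPart P e, y v = true) ∧
      ∃ v ∈ lowPart P e, y v = false := by
  constructor
  · intro h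
    refine ⟨fun i hi => ?_, ?_, ?_⟩
    · obtain ⟨v, hv, hvi⟩ := h i
      refine ⟨v, hv, ?_⟩
      unfold reassign at hvi
      split_ifs at hvi <;> first | exact hvi | (subst hvi; simp at hi)
    · obtain ⟨v, hv, hvi⟩ := h ⟨0, by omega⟩
      unfold reassign at hvi
      refine ⟨v, ?_, ?_⟩ <;> split_ifs at hvi <;> simp_all [lowPart, Fin.ext_iff]
    · obtain ⟨v, hv, hvi⟩ := h ⟨1, by omega⟩
      unfold reassign at hvi
      refine ⟨v, ?_, ?_⟩ <;> split_ifs at hvi <;> simp_all [lowPart, Fin.ext_iff]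
  · rintro ⟨h, ⟨a, ha, hya⟩, b, hb, hyb⟩ i
    rw [lowPart, mem_filter] at ha hb
    by_cases h0 : i.val = 0
    · exact ⟨a, ha.1, by simp [reassign, ha.2, hya, Fin.ext_iff, h0]⟩
    by_cases h1 : i.val = 1
    · exact ⟨b, hb.1, by simp [reassign, hb.2, hyb, Fin.ext_iff, h1]⟩
    obtain ⟨v, hv, hvi⟩ := h i (by omega)
    refine ⟨v, hv, ?_⟩
    have : ¬ (P v).val < 2 := by rw [hvi]; omega
    rw [reassign, if_neg this, hvi]

/-- Hitting the `k - 2` fixed parts uses up that many vertices that are not free. When `#e ≤ k + 1`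
at most three free vertices remain. -/
theorem IsHit.card_le {P : V → Fin k} {e : Finset V} (h : IsHit P e) :
    #(lowPart P e) + (k - 2) ≤ #e := by
  have h1 : #({i : Fin k | 2 ≤ i.val} : Finset (Fin k)) ≤ #{v ∈ e | ¬ (P v).val < 2} := by
    refine card_le_card_of_surjOn P ?_
    intro i hi
    simp only [coe_filter, mem_univ, true_and, Set.mem_ofPred_eq] at hi
    obtain ⟨v, hv, rfl⟩ := h i hi
    exact ⟨v, by simpa using ⟨hv, hi⟩, rfl⟩
  have h2 : k - 2 ≤ #({i : Fin k | 2 ≤ i.val} : Finset (Fin k)) := by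
    have h3 := card_filter_add_card_filter_not (s := (univ : Finset (Fin k)))
      (p := fun i : Fin k => i.val < 2)
    have h4 : #({i : Fin k | i.val < 2} : Finset (Fin k)) ≤ 2 := by
      have : #({i : Fin k | i.val < 2} : Finset (Fin k)) ≤ #(range 2) := by
        refine card_le_card_of_injOn (fun i => i.val) (fun i hi => by simpa using hi) ?_
        exact fun i _ j _ hij => Fin.ext hij
      simpa using this
    simp only [not_lt, card_univ, Fintype.card_fin] at h3
    omega
  have h3 := card_filter_add_card_filter_not (s := e) (p := fun v => (P v).val < 2)
  unfold lowPart
  omega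

/-- Two signs differ with indicator `1/2 - y₁y₂/2`; three are not all equal with indicator `3/4 -
(y₁y₂ + y₁y₃ + y₂y₃)/4`. Summing over ordered pairs halves the coefficients to `1/4` and `1/8`. With
four signs a quartic term would appear, hence the restriction on `#e`. -/
theorem ite_isCut_reassign (hk : 3 ≤ k) (P : V → Fin k) (y : V → Bool) (e : Finset V)
    (he : #e ≤ k + 1) :
    (if IsCut (reassign hk P y) e then (1 : ℝ) else 0) =
      (if IsHit P e then cutProb #(lowPart P e) else 0) -
        ∑ u, ∑ x, edgeWeight P e u x * (sgn (y u) * sgn (y x)) := by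
  by_cases hH : IsHit P e
  swap
  · simp [isCut_reassign, hH, edgeWeight]
  have hb : #(lowPart P e) ≤ 3 := by have := hH.card_le; omega
  have hsum : ∑ u, ∑ x, edgeWeight P e u x * (sgn (y u) * sgn (y x)) =
      pairWeight #(lowPart P e) *
        ∑ u ∈ lowPart P e, ∑ x ∈ lowPart P e, if u ≠ x then sgn (y u) * sgn (y x) else 0 := by
    rw [mul_sum]
    rw [← sum_subset (subset_univ (lowPart P e))]
    · refine sum_congr rfl fun u hu => ?_
      rw [mul_sum, ← sum_subset (subset_univ (lowPart P e))]
      · refine sum_congr rfl fun x hx => ?_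
        by_cases hux : u = x <;> simp [edgeWeight, hux, hu, hx, hH]
      · intro x _ hx
        simp [edgeWeight, hx]
    · intro u _ hu
      simp [edgeWeight, hu]
  rw [hsum]
  simp only [isCut_reassign, hH, true_and, if_true]
  generalize lowPart P e = B at hb
  obtain h | h | h | h : #B = 0 ∨ #B = 1 ∨ #B = 2 ∨ #B = 3 := by omega
  · rw [card_eq_zero] at h
    subst h
    simp [cutProb]
  · obtain ⟨a, rfl⟩ := card_eq_one.1 h
    cases y a <;> simp [cutProb]
  · obtain ⟨a, b, hab, rfl⟩ := card_eq_two.1 h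
    rw [h]
    simp only [sum_insert, mem_singleton, hab, not_false_eq_true, sum_singleton, ne_eq]
    have hba := hab.symm
    cases ha : y a <;> cases hb : y b <;>
      simp [cutProb, pairWeight, hba, ha, hb, sgn] <;> norm_num
  · obtain ⟨a, b, c, hab, hac, hbc, rfl⟩ := card_eq_three.1 h
    rw [h]
    have hba := hab.symm
    have hca := hac.symm
    have hcb := hbc.symm
    cases ha : y a <;> cases hb : y b <;> cases hc : y c <;>
      simp [cutProb, pairWeight, hab, hba, hac, hca, hbc, hcb, ha, hb, hc, sgn] <;> norm_num

theorem cutCount_reassign (hk : 3 ≤ k) (E : Finset (Finset V)) (hE : ∀ e ∈ E, #e ≤ k + 1)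
    (P : V → Fin k) (y : V → Bool) :
    (cutCount E (reassign hk P y) : ℝ) =
      freeMean E P - ∑ u, ∑ x, freeWeight E P u x * (sgn (y u) * sgn (y x)) := by
  have h1 : (cutCount E (reassign hk P y) : ℝ) =
      ∑ e ∈ E, if IsCut (reassign hk P y) e then (1 : ℝ) else 0 := by
    rw [cutCount, sum_boole]
  have h2 : ∑ u, ∑ x, freeWeight E P u x * (sgn (y u) * sgn (y x)) =
      ∑ e ∈ E, ∑ u, ∑ x, edgeWeight P e u x * (sgn (y u) * sgn (y x)) := by
    simp only [freeWeight, sum_mul]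
    rw [sum_comm]
    simp_rw [sum_comm (s := E)]
    rw [sum_comm]
  rw [h1, h2, freeMean, ← sum_sub_distrib]
  exact sum_congr rfl fun e he => ite_isCut_reassign hk P y e (hE e he)

theorem freeWeight_nonneg (E : Finset (Finset V)) (P : V → Fin k) (u x : V) :
    0 ≤ freeWeight E P u x := by
  refine sum_nonneg fun e _ => ?_
  unfold edgeWeight pairWeight
  split_ifs <;> norm_num

theorem freeWeight_self (E : Finset (Finset V)) (P : V → Fin k) (u : V) :
    freeWeight E P u u = 0 := by
  simp [freeWeight, edgeWeight]

theorem edgeWeight_le (P : V → Fin k) (e : Finset V) (u x : V) :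
    edgeWeight P e u x ≤ if u ∈ e ∧ x ∈ e then 1 else 0 := by
  unfold edgeWeight pairWeight lowPart
  split_ifs <;> simp_all <;> norm_num

theorem sum_freeWeight_le (E : Finset (Finset V)) {r : ℕ} (hE : ∀ e ∈ E, #e = r)
    (P : V → Fin k) : ∑ u, ∑ x, freeWeight E P u x ≤ (r : ℝ) ^ 2 * #E := by
  have h1 : ∑ u, ∑ x, freeWeight E P u x = ∑ e ∈ E, ∑ u, ∑ x, edgeWeight P e u x := by
    simp only [freeWeight]
    simp_rw [sum_comm (s := univ) (t := E)]
  rw [h1]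
  calc ∑ e ∈ E, ∑ u, ∑ x, edgeWeight P e u x ≤ ∑ e ∈ E, (r : ℝ) ^ 2 := by
        refine sum_le_sum fun e he => ?_
        calc ∑ u, ∑ x, edgeWeight P e u x
            ≤ ∑ u, ∑ x, (if u ∈ e ∧ x ∈ e then (1 : ℝ) else 0) :=
              sum_le_sum fun u _ => sum_le_sum fun x _ => edgeWeight_le P e u x
          _ = (r : ℝ) ^ 2 := by
              simp only [ite_and]
              simp [hE e he, sq]
    _ = _ := by rw [sum_const, nsmul_eq_mul, mul_comm]

/-- Two assignments that agree up to exchanging the first two parts. -/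
def SameFree (P Q : V → Fin k) : Prop := ∀ v, P v = Q v ∨ (P v).val < 2 ∧ (Q v).val < 2

theorem SameFree.lowPart_eq {P Q : V → Fin k} (h : SameFree P Q) (e : Finset V) :
    lowPart P e = lowPart Q e := by
  unfold lowPart
  refine filter_congr fun v _ => ?_
  rcases h v with h | h
  · rw [h]
  · simp [h]

theorem SameFree.isHit_iff {P Q : V → Fin k} (h : SameFree P Q) (e : Finset V) :
    IsHit P e ↔ IsHit Q e := by
  unfold IsHit
  refine forall_congr' fun i => imp_congr_right fun hi => exists_congr fun v =>
    and_congr_right fun _ => ?_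
  rcases h v with h | h
  · rw [h]
  · constructor <;> rintro rfl <;> omega

theorem SameFree.edgeWeight_eq {P Q : V → Fin k} (h : SameFree P Q) (e : Finset V) (u x : V) :
    edgeWeight P e u x = edgeWeight Q e u x := by
  simp only [edgeWeight, h.lowPart_eq, h.isHit_iff]

/-- Exchange the first two parts at the vertex `u`. -/
def flipAt (hk : 3 ≤ k) (u : V) (P : V → Fin k) : V → Fin k :=
  Function.update P u (Equiv.swap ⟨0, by omega⟩ ⟨1, by omega⟩ (P u))

theorem flipAt_involutive (hk : 3 ≤ k) (u : V) :
    Function.Involutive (flipAt hk u : (V → Fin k) → V → Fin k) := by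
  intro P
  simp [flipAt]

theorem sameFree_flipAt (hk : 3 ≤ k) (u : V) (P : V → Fin k) : SameFree P (flipAt hk u P) := by
  intro v
  by_cases hv : v = u
  · subst hv
    simp only [flipAt, Function.update_self]
    rcases lt_or_ge (P v).val 2 with h | h
    · right
      refine ⟨h, ?_⟩
      rw [Equiv.swap_apply_def]
      split_ifs <;> simp [h]
    · left
      rw [Equiv.swap_apply_of_ne_of_ne] <;> (intro h'; rw [h'] at h; simp at h)
  · left
    simp [flipAt, hv]

/-- The label of a free vertex. -/
def freeLabel (P : V → Fin k) (v : V) : Bool := decide ((P v).val = 0)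

theorem reassign_freeLabel (hk : 3 ≤ k) (P : V → Fin k) : reassign hk P (freeLabel P) = P := by
  ext v
  unfold reassign freeLabel
  split_ifs with h1 h2 <;> simp_all; omega

/-- Exchanging the first two parts at `u` preserves the weight and, when `u` is free, negates its
sign; when `u` is not free the weight vanishes. -/
theorem expect_edgeWeight_mul_sgn (hk : 3 ≤ k) (e : Finset V) (u x : V) :
    𝔼 P : V → Fin k, edgeWeight P e u x * (sgn (freeLabel P u) * sgn (freeLabel P x)) = 0 := by
  by_cases hux : u = x
  · simp [edgeWeight, hux]
  have h : 𝔼 P : V → Fin k, edgeWeight P e u x * (sgn (freeLabel P u) * sgn (freeLabel P x)) =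
      𝔼 P : V → Fin k, -(edgeWeight P e u x * (sgn (freeLabel P u) * sgn (freeLabel P x))) := by
    refine Fintype.expect_equiv (flipAt_involutive hk u).toPerm _ _ fun P => ?_
    change _ = -(edgeWeight (flipAt hk u P) e u x * (sgn (freeLabel (flipAt hk u P) u) *
      sgn (freeLabel (flipAt hk u P) x)))
    rw [← (sameFree_flipAt hk u P).edgeWeight_eq]
    by_cases hu : (P u).val < 2
    · have h1 : sgn (freeLabel (flipAt hk u P) u) = -sgn (freeLabel P u) := by
        rw [← sgn_not]
        congr 1
        simp only [freeLabel, flipAt, Function.update_self]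
        rw [Equiv.swap_apply_def]
        obtain h0 | h0 : (P u).val = 0 ∨ (P u).val = 1 := by omega
        · simp [Fin.ext_iff, h0]
        · simp [Fin.ext_iff, h0]
      have h2 : freeLabel (flipAt hk u P) x = freeLabel P x := by
        simp [freeLabel, flipAt, Ne.symm hux]
      rw [h1, h2]
      ring
    · have : edgeWeight P e u x = 0 := by
        simp only [edgeWeight, lowPart, mem_filter, hu, and_false, false_and, if_false]
      simp [this]
  rw [Finset.expect_neg_distrib] at h
  linarith

/-- Reassigning by `freeLabel P` gives back `P`, so `freeMean` differs from the number of cut edges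
by a quadratic term of mean zero. -/
theorem expect_freeMean (hk : 3 ≤ k) (E : Finset (Finset V)) {r : ℕ} (hE : ∀ e ∈ E, #e = r)
    (hr : r ≤ k + 1) :
    𝔼 P : V → Fin k, freeMean E P =
      (r.stirlingSecond k : ℝ) * k.factorial / (k : ℝ) ^ r * #E := by
  have : NeZero k := ⟨by omega⟩
  have h1 : ∀ P : V → Fin k, freeMean E P = (∑ e ∈ E, if IsCut P e then (1 : ℝ) else 0) +
      ∑ e ∈ E, ∑ u, ∑ x, edgeWeight P e u x * (sgn (freeLabel P u) * sgn (freeLabel P x)) := by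
    intro P
    rw [freeMean, ← sum_add_distrib]
    refine sum_congr rfl fun e he => ?_
    have := ite_isCut_reassign hk P (freeLabel P) e (by rw [hE e he]; exact hr)
    rw [reassign_freeLabel] at this
    linarith
  simp_rw [h1]
  rw [Finset.expect_add_distrib]
  simp_rw [Finset.expect_sum_comm, expect_edgeWeight_mul_sgn hk, sum_const_zero, add_zero]
  rw [sum_congr rfl fun e he => by rw [expect_isCut, hE e he], sum_const, nsmul_eq_mul, mul_comm]

end Cut

/-! ### Lower bounds for the surplus from test matrices. -/

section Surplus

variable {V : Type*} [Fintype V] [DecidableEq V] {k : ℕ}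

/-- The expected number of cut edges in a uniformly random `k`-cut. -/
noncomputable def baseline (E : Finset (Finset V)) (r k : ℕ) : ℝ :=
  (r.stirlingSecond k : ℝ) * k.factorial / (k : ℝ) ^ r * #E

theorem expect_cutCount [NeZero k] (E : Finset (Finset V)) {r : ℕ} (hE : ∀ e ∈ E, #e = r) :
    𝔼 P : V → Fin k, (cutCount E P : ℝ) = baseline E r k := by
  have h1 : ∀ P : V → Fin k, (cutCount E P : ℝ) = ∑ e ∈ E, if IsCut P e then (1 : ℝ) else 0 := by
    intro P
    rw [cutCount, sum_boole]
  simp_rw [h1]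
  rw [Finset.expect_sum_comm, sum_congr rfl fun e he => by rw [expect_isCut, hE e he], sum_const,
    nsmul_eq_mul, mul_comm, baseline]

theorem stirlingSecond_pos {r k : ℕ} (hk : 1 ≤ k) (hkr : k ≤ r) : 0 < r.stirlingSecond k := by
  have h : 0 < #{f : Fin r → Fin k | Function.Surjective f} := by
    refine card_pos.2 ⟨fun i => ⟨min i.val (k - 1), by omega⟩, ?_⟩
    simp only [mem_filter, mem_univ, true_and]
    intro j
    refine ⟨⟨j.val, by omega⟩, Fin.ext ?_⟩
    simp only [inf_eq_left]
    omega
  rw [card_surjective_fin] at h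
  exact Nat.pos_of_mul_pos_right h

/-- Some cut beats the random one, by at least one over the common denominator. -/
theorem one_div_pow_le_surplus (E : Finset (Finset V)) {r : ℕ} (hE : ∀ e ∈ E, #e = r)
    (hE0 : E.Nonempty) (hk : 3 ≤ k) (hkr : k ≤ r) {s : ℝ}
    (hs : ∀ P : V → Fin k, (cutCount E P : ℝ) ≤ baseline E r k + s) : 1 / (k : ℝ) ^ r ≤ s := by
  have : NeZero k := ⟨by omega⟩
  have hkp : (0 : ℝ) < (k : ℝ) ^ r := by positivity
  have hcard : (0 : ℝ) < #E := by exact_mod_cast hE0.card_pos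
  have hbase : 0 < baseline E r k := by
    have h1 : (0 : ℝ) < r.stirlingSecond k := by exact_mod_cast stirlingSecond_pos (by omega) hkr
    have h2 : (0 : ℝ) < k.factorial := by exact_mod_cast Nat.factorial_pos k
    unfold baseline
    positivity
  -- A constant map cuts nothing, which is below the mean, so some other map lies strictly above the
  -- mean.
  have hex : ∃ P : V → Fin k, baseline E r k < cutCount E P := by
    by_contra hcon
    push Not at hcon
    have h0 : cutCount E (fun _ => ⟨0, by omega⟩ : V → Fin k) = 0 := by
      rw [cutCount, card_eq_zero, filter_eq_empty_iff]
      intro e _ he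
      obtain ⟨v, -, hv⟩ := he ⟨1, by omega⟩
      simp at hv
    have h1 : 𝔼 P : V → Fin k, (cutCount E P : ℝ) < baseline E r k :=
      Finset.expect_lt (fun P _ => hcon P) ⟨_, mem_univ _, by rw [h0]; simpa using hbase⟩
    rw [expect_cutCount E hE] at h1
    exact lt_irrefl _ h1
  obtain ⟨P, hP⟩ := hex
  have h1 : baseline E r k * (k : ℝ) ^ r = ((r.stirlingSecond k * k.factorial * #E : ℕ) : ℝ) := by
    unfold baseline
    push_cast
    field_simp
  -- After clearing the denominator both sides are integers, so the strict inequality gains at least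
  -- 1.
  have h2 : r.stirlingSecond k * k.factorial * #E < cutCount E P * k ^ r := by
    have := mul_lt_mul_of_pos_right hP hkp
    rw [h1] at this
    exact_mod_cast this
  have h3 : ((r.stirlingSecond k * k.factorial * #E : ℕ) : ℝ) + 1 ≤
      cutCount E P * (k : ℝ) ^ r := by exact_mod_cast h2
  rw [div_le_iff₀ hkp]
  have h4 := mul_le_mul_of_nonneg_right (hs P) hkp.le
  rw [add_mul, h1] at h4
  linarith

/-- Semidefinite lower bound for the surplus: every family of test matrices `M P` with zero diagonal
and `M P ≤ 1` gives a lower bound. -/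
theorem expect_test_le_surplus (E : Finset (Finset V)) {r : ℕ} (hE : ∀ e ∈ E, #e = r)
    (hE0 : E.Nonempty) (hk : 3 ≤ k) (hkr : k ≤ r) (hrk : r ≤ k + 1) {s : ℝ}
    (hs : ∀ P : V → Fin k, (cutCount E P : ℝ) ≤ baseline E r k + s)
    (M : (V → Fin k) → Matrix V V ℝ) (hM0 : ∀ P u, M P u u = 0)
    (hM : ∀ P, (1 - M P).PosSemidef) :
    (𝔼 P, ∑ u, ∑ x, freeWeight E P u x * M P u x) / (4 * (1 + Real.log #E)) ≤
      (1 + (r : ℝ) ^ 2 * (k : ℝ) ^ r) * s := by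
  have : NeZero k := ⟨by omega⟩
  have hcard : (1 : ℝ) ≤ #E := by exact_mod_cast hE0.card_pos
  have hL : 0 ≤ Real.log #E := Real.log_nonneg hcard
  -- With this `T` the error factor `exp (-T ^ 2 / 4)` is at most `1 / #E`, which cancels the total
  -- weight `r ^ 2 * #E`.
  set T := 2 * √(1 + Real.log #E) with hT
  have hT2 : T ^ 2 = 4 * (1 + Real.log #E) := by
    rw [hT, mul_pow, Real.sq_sqrt (by linarith)]; norm_num
  have hTge : 2 ≤ T := by
    have : 1 ≤ √(1 + Real.log #E) := Real.one_le_sqrt.2 (by linarith)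
    linarith
  have hexp : Real.exp (-T ^ 2 / 4) * #E ≤ 1 := by
    have h1 : Real.exp (-T ^ 2 / 4) ≤ Real.exp (-Real.log #E) :=
      Real.exp_le_exp.2 (by rw [neg_div, hT2]; linarith)
    rw [Real.exp_neg, Real.exp_log (by linarith)] at h1
    calc Real.exp (-T ^ 2 / 4) * #E ≤ (#E : ℝ)⁻¹ * #E :=
          mul_le_mul_of_nonneg_right h1 (by linarith)
      _ = 1 := inv_mul_cancel₀ (by linarith)
  have hP : ∀ P : V → Fin k, freeMean E P +
      1 / T ^ 2 * (∑ u, ∑ x, freeWeight E P u x * M P u x) - (r : ℝ) ^ 2 ≤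
        baseline E r k + s := by
    intro P
    obtain ⟨y, hy⟩ := exists_sign_le_of_posSemidef (freeWeight E P) (freeWeight_self E P)
      (freeWeight_nonneg E P) (1 - M P) (hM P) (fun u => by simp [hM0]) hTge
    have h1 : ∑ u, ∑ x, freeWeight E P u x * (1 - M P) u x =
        -∑ u, ∑ x, freeWeight E P u x * M P u x := by
      rw [← sum_neg_distrib]
      refine sum_congr rfl fun u _ => ?_
      rw [← sum_neg_distrib]
      refine sum_congr rfl fun x _ => ?_
      by_cases hux : u = x
      · subst hux; simp [freeWeight_self]
      · simp [Matrix.one_apply_ne hux]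
    rw [h1] at hy
    have h2 := hs (reassign hk P y)
    rw [cutCount_reassign hk E (fun e he => (hE e he).le.trans hrk)] at h2
    have h3 : 2 * Real.exp (-T ^ 2 / 4) * ∑ u, ∑ x, freeWeight E P u x ≤ 2 * (r : ℝ) ^ 2 := by
      have := mul_le_mul_of_nonneg_left (sum_freeWeight_le E hE P)
        (Real.exp_pos (-T ^ 2 / 4)).le
      nlinarith [sq_nonneg (r : ℝ)]
    have h4 : 1 / T ^ 2 * (2 * Real.exp (-T ^ 2 / 4) * ∑ u, ∑ x, freeWeight E P u x) ≤
        (r : ℝ) ^ 2 := by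
      have h5 : 1 / T ^ 2 ≤ 1 / 2 := one_div_le_one_div_of_le (by norm_num) (by nlinarith)
      have h6 : 0 ≤ 2 * Real.exp (-T ^ 2 / 4) * ∑ u, ∑ x, freeWeight E P u x := by
        have := sum_nonneg fun u (_ : u ∈ univ) => sum_nonneg fun x (_ : x ∈ univ) =>
          freeWeight_nonneg E P u x
        have := Real.exp_pos (-T ^ 2 / 4)
        positivity
      nlinarith
    rw [mul_add] at hy
    linarith
  have hE1 := expect_mono hP
  rw [Finset.expect_sub_distrib, Finset.expect_add_distrib, ← Finset.mul_expect,
    expect_freeMean hk E hE hrk, Fintype.expect_const, Fintype.expect_const, hT2] at hE1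
  change baseline E r k + _ - _ ≤ _ at hE1
  -- Since `s ≥ 1 / k ^ r`, the additive error `r ^ 2` is absorbed into a multiple of `s`.
  have h5 := one_div_pow_le_surplus E hE hE0 hk hkr hs
  have hkp : (0 : ℝ) < (k : ℝ) ^ r := by positivity
  rw [div_le_iff₀ hkp] at h5
  rw [div_eq_mul_one_div, mul_comm]
  have h6 : (r : ℝ) ^ 2 * 1 ≤ (r : ℝ) ^ 2 * (s * (k : ℝ) ^ r) :=
    mul_le_mul_of_nonneg_left h5 (sq_nonneg _)
  linarith

end Surplus

/-! ### Resampling a single coordinate. -/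

section Resample

variable {V Ω : Type*} [Fintype V] [DecidableEq V] [Fintype Ω]

/-- Resampling one coordinate of a uniformly random function is a measure-preserving involution. -/
theorem expect_resample_swap (v : V) (H : (V → Ω) → Ω → ℝ) :
    𝔼 P : V → Ω, 𝔼 c, H P c = 𝔼 P : V → Ω, 𝔼 c, H (Function.update P v c) (P v) := by
  rw [← Finset.expect_product' univ univ H,
    ← Finset.expect_product' univ univ fun P c => H (Function.update P v c) (P v),
    Finset.univ_product_univ]
  have hinv : Function.Involutive fun p : (V → Ω) × Ω => (Function.update p.1 v p.2, p.1 v) := by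
    rintro ⟨P, c⟩
    simp
  exact Fintype.expect_equiv hinv.toPerm _ _ fun p => by
    simp [Function.Involutive.toPerm]

theorem expect_resample [Nonempty Ω] (v : V) (G : (V → Ω) → ℝ) :
    𝔼 P : V → Ω, G P = 𝔼 P : V → Ω, 𝔼 c, G (Function.update P v c) := by
  rw [← expect_resample_swap v fun P _ => G P]
  exact Finset.expect_congr rfl fun P _ => (Fintype.expect_const _).symm

end Resample

/-! ### Correlation of edge weights with the part of a vertex. -/

section Correlation

variable {V : Type*} [Fintype V] [DecidableEq V] {k : ℕ}

/-- A nonnegative function of the values on `e` has expectation at least any of its values, divided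
by the number of assignments of `e`. -/
theorem le_expect_of_local [NeZero k] (e : Finset V) (F : (V → Fin k) → ℝ) (hF : ∀ P, 0 ≤ F P)
    (hloc : ∀ P Q : V → Fin k, (∀ v ∈ e, P v = Q v) → F P = F Q) (P₀ : V → Fin k) :
    F P₀ / (k : ℝ) ^ #e ≤ 𝔼 P, F P := by
  have h1 : 𝔼 P : V → Fin k,
      (if (fun v : e => P v) = (fun v : e => P₀ v) then F P₀ else 0) ≤ 𝔼 P, F P := by
    refine expect_mono fun P => ?_
    split_ifs with h
    · exact (hloc P₀ P fun v hv => (congrFun h ⟨v, hv⟩).symm).le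
    · exact hF P
  rw [expect_restrict e fun Q : e → Fin k => if Q = (fun v : e => P₀ v) then F P₀ else 0,
    Fintype.expect_eq_sum_div_card, sum_ite_eq' univ (fun v : e => P₀ v) fun _ => F P₀] at h1
  simpa using h1

theorem edgeWeight_nonneg (P : V → Fin k) (e : Finset V) (u x : V) : 0 ≤ edgeWeight P e u x := by
  unfold edgeWeight pairWeight
  split_ifs <;> norm_num

theorem edgeWeight_congr {e : Finset V} {P Q : V → Fin k} (h : ∀ v ∈ e, P v = Q v) (u x : V) :
    edgeWeight P e u x = edgeWeight Q e u x := by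
  have h1 : lowPart P e = lowPart Q e := filter_congr fun v hv => by rw [h v hv]
  have h2 : IsHit P e ↔ IsHit Q e := by
    unfold IsHit
    exact forall_congr' fun i => imp_congr_right fun _ => exists_congr fun v =>
      and_congr_right fun hv => by rw [h v hv]
  simp only [edgeWeight, h1, h2]

/-- An assignment of `e` in which `u` and `x` are free and `v` is alone in its part. -/
theorem exists_isHit (hk : 3 ≤ k) {e : Finset V} (hke : k ≤ #e) {u x v : V} (hu : u ∈ e)
    (hx : x ∈ e) (hv : v ∈ e) (hux : u ≠ x) (hvu : v ≠ u) (hvx : v ≠ x) :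
    ∃ P : V → Fin k, (P u).val = 0 ∧ (P x).val = 0 ∧ (P v).val = 2 ∧ IsHit P e ∧
      ∀ w, (P w).val = 2 → w = v := by
  have hcard : #((e.erase u).erase x) = #e - 2 := by
    rw [card_erase_of_mem (mem_erase.2 ⟨hux.symm, hx⟩), card_erase_of_mem hu]
    omega
  set D := (e.erase u).erase x with hD
  have hvD : v ∈ D := by simp [hD, hv, hvu, hvx]
  obtain ⟨f, hf⟩ : ∃ f : D ≃ Fin (#e - 2), f ⟨v, hvD⟩ = ⟨0, by omega⟩ := by
    have f₀ : D ≃ Fin (#e - 2) := D.equivFinOfCardEq hcard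
    exact ⟨f₀.trans (Equiv.swap (f₀ ⟨v, hvD⟩) ⟨0, by omega⟩), by simp⟩
  -- The vertex with index `i` goes to part `i + 2`, so `v` goes to part 2; all surplus indices and
  -- all vertices outside `D` go to part 0.
  let P : V → Fin k := fun w =>
    if h : w ∈ D then if h' : (f ⟨w, h⟩).val + 2 < k then ⟨(f ⟨w, h⟩).val + 2, h'⟩
      else ⟨0, by omega⟩ else ⟨0, by omega⟩
  refine ⟨P, by simp [P, hD], by simp [P, hD], ?_, ?_, ?_⟩
  · simp only [P, hvD, dif_pos, hf]
    rw [dif_pos (by omega)]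
  · intro i hi
    have hi2 := i.isLt
    refine ⟨f.symm ⟨i.val - 2, by omega⟩, ?_, ?_⟩
    · have := (f.symm ⟨i.val - 2, by omega⟩).2
      exact mem_of_mem_erase (mem_of_mem_erase this)
    · have hmem := (f.symm ⟨i.val - 2, by omega⟩).2
      simp only [P, hmem, dif_pos, Subtype.coe_eta, Equiv.apply_symm_apply]
      rw [dif_pos (by omega)]
      exact Fin.ext (by simp; omega)
  · intro w hw
    simp only [P] at hw
    split_ifs at hw with h h'
    · have h0 : f ⟨w, h⟩ = f ⟨v, hvD⟩ := by
        rw [hf]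
        exact Fin.ext (by simpa using hw)
      simpa using congrArg Subtype.val (f.injective h0)

theorem one_div_eight_le_edgeWeight {e : Finset V} (hek : #e ≤ k + 1)
    {u x : V} (hu : u ∈ e) (hx : x ∈ e) (hux : u ≠ x) {P : V → Fin k} (hPu : (P u).val < 2)
    (hPx : (P x).val < 2) (hP : IsHit P e) (hk : 3 ≤ k) : 1 / 8 ≤ edgeWeight P e u x := by
  have hul : u ∈ lowPart P e := mem_filter.2 ⟨hu, hPu⟩
  have hxl : x ∈ lowPart P e := mem_filter.2 ⟨hx, hPx⟩
  have h1 := hP.card_le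
  have h2 : 1 < #(lowPart P e) := one_lt_card.2 ⟨u, hul, x, hxl, hux⟩
  rw [edgeWeight, if_pos ⟨hux, hul, hxl, hP⟩]
  obtain h | h : #(lowPart P e) = 2 ∨ #(lowPart P e) = 3 := by omega
  · rw [h, pairWeight]; norm_num
  · rw [h, pairWeight]; norm_num

theorem le_expect_edgeWeight (hk : 3 ≤ k) {e : Finset V} (hke : k ≤ #e) (hek : #e ≤ k + 1)
    {u x : V} (hu : u ∈ e) (hx : x ∈ e) (hux : u ≠ x) :
    1 / 8 / (k : ℝ) ^ #e ≤ 𝔼 P : V → Fin k, edgeWeight P e u x := by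
  have : NeZero k := ⟨by omega⟩
  obtain ⟨v, hv, hvux⟩ : ∃ v ∈ e, v ∉ ({u, x} : Finset V) := by
    refine exists_mem_notMem_of_card_lt_card ?_
    have := card_le_two (a := u) (b := x)
    omega
  simp only [mem_insert, mem_singleton, not_or] at hvux
  obtain ⟨P, hPu, hPx, -, hP, -⟩ := exists_isHit hk hke hu hx hv hux hvux.1 hvux.2
  refine le_trans ?_ (le_expect_of_local e _ (fun P => edgeWeight_nonneg P e u x)
    (fun P Q h => edgeWeight_congr h u x) P)
  exact div_le_div_of_nonneg_right (one_div_eight_le_edgeWeight hek hu hx hux (by omega)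
    (by omega) hP hk) (by positivity)

/-- A mean zero function of the part of a vertex that separates the free vertices. -/
noncomputable def balance (p : Fin k) : ℝ :=
  if p.val < 2 then -(((k : ℝ) - 2) / k) else 2 / k

theorem abs_balance_le (hk : 3 ≤ k) (p : Fin k) : |balance p| ≤ 1 := by
  have hk' : (3 : ℝ) ≤ k := by exact_mod_cast hk
  unfold balance
  split_ifs
  · rw [abs_neg, abs_of_nonneg (by apply div_nonneg <;> linarith), div_le_one (by linarith)]
    linarith
  · rw [abs_of_nonneg (by positivity), div_le_one (by linarith)]
    linarith

theorem expect_balance (hk : 3 ≤ k) : 𝔼 p : Fin k, balance p = 0 := by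
  have h1 : ∑ p : Fin k, balance p = 0 := by
    obtain ⟨n, rfl⟩ : ∃ n, k = n + 2 := ⟨k - 2, by omega⟩
    rw [Fin.sum_univ_succ, Fin.sum_univ_succ]
    have h2 : ∀ i : Fin n, balance (i.succ.succ : Fin (n + 2)) = 2 / ((n + 2 : ℕ) : ℝ) := by
      intro i
      rw [balance, if_neg (by simp)]
    simp_rw [h2]
    simp [balance]
    field_simp
    ring
  rw [Fintype.expect_eq_sum_div_card, h1, zero_div]

/-- If the pair has positive weight while `v` is free, then `u`, `x`, `v` are exactly the free
vertices and the weight is `1/8`. Fixing `v` leaves two free vertices and no part unhit, so the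
weight rises to `1/4`. -/
theorem edgeWeight_update_le (hk : 3 ≤ k) {e : Finset V} (hek : #e ≤ k + 1) {u x v : V}
    (hv : v ∈ e) (hvu : v ≠ u) (hvx : v ≠ x) (P : V → Fin k) {b c : Fin k} (hb : b.val < 2)
    (hc : 2 ≤ c.val) :
    edgeWeight (Function.update P v b) e u x ≤ edgeWeight (Function.update P v c) e u x := by
  by_cases h : u ≠ x ∧ u ∈ lowPart (Function.update P v b) e ∧
      x ∈ lowPart (Function.update P v b) e ∧ IsHit (Function.update P v b) e
  swap
  · rw [edgeWeight, if_neg h]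
    exact edgeWeight_nonneg _ _ _ _
  obtain ⟨hux, hu, hx, hH⟩ := h
  have hl : lowPart (Function.update P v b) e =
      insert v (lowPart (Function.update P v c) e) := by
    ext w
    by_cases hw : w = v
    · subst hw
      simp [lowPart, hv]
      omega
    · simp [lowPart, hw]
  have hnot : v ∉ lowPart (Function.update P v c) e := by
    simp [lowPart]
    omega
  rw [hl, mem_insert] at hu hx
  have hu' := hu.resolve_left hvu.symm
  have hx' := hx.resolve_left hvx.symm
  have hH' : IsHit (Function.update P v c) e := by
    intro i hi
    obtain ⟨w, hw, hwi⟩ := hH i hi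
    have hwv : w ≠ v := by
      rintro rfl
      rw [Function.update_self] at hwi
      rw [hwi] at hb
      omega
    exact ⟨w, hw, by rw [Function.update_of_ne hwv] at hwi ⊢; exact hwi⟩
  have h1 := hH.card_le
  have h2 : 1 < #(lowPart (Function.update P v c) e) := one_lt_card.2 ⟨u, hu', x, hx', hux⟩
  rw [hl, card_insert_of_notMem hnot] at h1
  have h3 : #(lowPart (Function.update P v c) e) = 2 := by omega
  have h4 : edgeWeight (Function.update P v b) e u x = 1 / 8 := by
    rw [edgeWeight, if_pos ⟨hux, by rw [hl]; exact mem_insert_of_mem hu',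
      by rw [hl]; exact mem_insert_of_mem hx', hH⟩, hl, card_insert_of_notMem hnot, h3]
    norm_num [pairWeight]
  have h5 : edgeWeight (Function.update P v c) e u x = 1 / 4 := by
    rw [edgeWeight, if_pos ⟨hux, hu', hx', hH'⟩, h3]
    norm_num [pairWeight]
  rw [h4, h5]
  norm_num

/-- As `balance` has mean zero, the weight with `v` in part 0 can be subtracted after resampling
`v`; every term is then nonnegative by `edgeWeight_update_le`. One assignment contributes at least
`(2 / k) * (1 / 8)`, divided by `k` for the average over the part of `v`. -/
theorem le_expect_edgeWeight_mul_balance (hk : 3 ≤ k) {e : Finset V} (hke : k ≤ #e)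
    (hek : #e ≤ k + 1) {u x v : V} (hu : u ∈ e) (hx : x ∈ e) (hv : v ∈ e) (hux : u ≠ x)
    (hvu : v ≠ u) (hvx : v ≠ x) :
    1 / (4 * (k : ℝ) ^ 2) / (k : ℝ) ^ #e ≤
      𝔼 P : V → Fin k, edgeWeight P e u x * balance (P v) := by
  have : NeZero k := ⟨by omega⟩
  have hk0 : (0 : ℝ) < k := by positivity
  let z : Fin k := ⟨0, by omega⟩
  let F : (V → Fin k) → Fin k → ℝ := fun P c => edgeWeight (Function.update P v c) e u x
  have hlow : ∀ P (c : Fin k), c.val < 2 → F P c = F P z := by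
    intro P c hc
    refine SameFree.edgeWeight_eq (fun w => ?_) e u x
    by_cases hw : w = v
    · subst hw; right; simpa [z] using (by omega : c.val ≤ 1)
    · left; simp [hw]
  have hterm : ∀ P c, 0 ≤ balance c * (F P c - F P z) := by
    intro P c
    by_cases hc : c.val < 2
    · rw [hlow P c hc]; simp
    · refine mul_nonneg ?_ (sub_nonneg.2 ?_)
      · rw [balance, if_neg hc]; positivity
      · exact edgeWeight_update_le hk hek hv hvu hvx P (by simp [z]) (by omega)
  have h1 : 𝔼 P : V → Fin k, edgeWeight P e u x * balance (P v) =
      𝔼 P : V → Fin k, 𝔼 c, balance c * (F P c - F P z) := by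
    rw [expect_resample v]
    refine Finset.expect_congr rfl fun P _ => ?_
    simp only [Function.update_self, mul_sub]
    rw [Finset.expect_sub_distrib, ← Finset.expect_mul, expect_balance hk, zero_mul, sub_zero]
    exact Finset.expect_congr rfl fun c _ => mul_comm _ _
  rw [h1]
  obtain ⟨P₀, hPu, hPx, hPv, hH, hP2⟩ := exists_isHit hk hke hu hx hv hux hvu hvx
  refine le_trans ?_ (le_expect_of_local e _ (fun P => expect_nonneg' (hterm P)) ?_ P₀)
  · refine div_le_div_of_nonneg_right ?_ (by positivity)
    -- In `P₀` only `v` lies in part 2, so moving it to part 0 leaves that part unhit.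
    have h2 : F P₀ z = 0 := by
      refine if_neg fun h => ?_
      obtain ⟨w, hw, hwi⟩ := h.2.2.2 ⟨2, by omega⟩ le_rfl
      by_cases hwv : w = v
      · subst hwv; simp [z] at hwi
      · rw [Function.update_of_ne hwv] at hwi
        exact hwv (hP2 w (by rw [hwi]))
    have h3 : 1 / 8 ≤ F P₀ (P₀ v) := by
      simp only [F, Function.update_eq_self]
      exact one_div_eight_le_edgeWeight hek hu hx hux (by omega) (by omega) hH hk
    have h4 : balance (P₀ v) * (F P₀ (P₀ v) - F P₀ z) ≤
        ∑ c, balance c * (F P₀ c - F P₀ z) :=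
      single_le_sum (f := fun c => balance c * (F P₀ c - F P₀ z)) (fun c _ => hterm P₀ c)
        (mem_univ _)
    rw [h2, sub_zero, balance, if_neg (by omega)] at h4
    rw [Fintype.expect_eq_sum_div_card, Fintype.card_fin, le_div_iff₀ hk0]
    rw [h2]
    refine le_trans ?_ h4
    calc 1 / (4 * (k : ℝ) ^ 2) * k = 2 / k * (1 / 8) := by field_simp; norm_num
      _ ≤ _ := mul_le_mul_of_nonneg_left h3 (by positivity)
  · intro P Q hPQ
    have : ∀ c, F P c = F Q c := by
      intro c
      refine edgeWeight_congr (fun w hw => ?_) u x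
      by_cases hwv : w = v
      · subst hwv; simp
      · simp [hwv, hPQ w hw]
    simp only [this]

/-- The weight depends only on the values on `e`, hence is independent of `P v`. -/
theorem expect_edgeWeight_mul_balance_of_notMem (hk : 3 ≤ k) {e : Finset V} {u x v : V}
    (hv : v ∉ e) : 𝔼 P : V → Fin k, edgeWeight P e u x * balance (P v) = 0 := by
  have : NeZero k := ⟨by omega⟩
  rw [expect_resample v]
  refine Finset.expect_eq_zero fun P _ => ?_
  have : ∀ c, edgeWeight (Function.update P v c) e u x = edgeWeight P e u x := fun c =>
    edgeWeight_congr (fun w hw => by rw [Function.update_of_ne]; rintro rfl; exact hv hw) u x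
  simp only [this, Function.update_self]
  rw [← Finset.mul_expect, expect_balance hk, mul_zero]

end Correlation

end Hypergraph

open Matrix

namespace Hypergraph

/-! ### Trace inequalities for symmetric matrices. -/

section TraceInequality

variable {V : Type*} [Fintype V] [DecidableEq V]

theorem pow_sub_pow_eq_sum {R : Type*} [Ring R] (X Y : R) (n : ℕ) :
    X ^ n - Y ^ n = ∑ q ∈ range n, X ^ q * (X - Y) * Y ^ (n - 1 - q) := by
  induction n with
  | zero => simp
  | succ n ih =>
    rw [sum_range_succ]
    have h1 : ∀ q ∈ range n, X ^ q * (X - Y) * Y ^ (n + 1 - 1 - q) =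
        X ^ q * (X - Y) * Y ^ (n - 1 - q) * Y := by
      intro q hq
      have : n + 1 - 1 - q = (n - 1 - q) + 1 := by have := mem_range.1 hq; omega
      rw [this, pow_succ, mul_assoc]
      simp only [mul_assoc]
    rw [sum_congr rfl h1, ← sum_mul, ← ih]
    simp only [Nat.add_sub_cancel, Nat.sub_self, pow_zero, mul_one, pow_succ]
    noncomm_ring

/-- Spectral decomposition of a real symmetric matrix and of its powers. -/
theorem exists_diagonalization {X : Matrix V V ℝ} (hX : X.IsHermitian) :
    ∃ (U : Matrix V V ℝ) (d : V → ℝ), U * Uᵀ = 1 ∧ Uᵀ * U = 1 ∧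
      ∀ n : ℕ, X ^ n = U * diagonal (fun i => d i ^ n) * Uᵀ := by
  set U : Matrix V V ℝ := (hX.eigenvectorUnitary).1 with hU
  have h1 : U * Uᵀ = 1 := mem_unitaryGroup_iff.1 hX.eigenvectorUnitary.2
  have h2 : Uᵀ * U = 1 := mem_unitaryGroup_iff'.1 hX.eigenvectorUnitary.2
  have h3 : X = U * diagonal hX.eigenvalues * Uᵀ := by
    have h4 := hX.spectral_theorem
    rw [Unitary.conjStarAlgAut_apply] at h4
    exact h4
  generalize hX.eigenvalues = d at h3
  refine ⟨U, d, h1, h2, fun n => ?_⟩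
  induction n with
  | zero => simp [h1]
  | succ n ih =>
    rw [pow_succ, ih]
    conv_lhs => rw [h3]
    have h5 : U * diagonal (fun i => d i ^ n) * Uᵀ *
        (U * diagonal d * Uᵀ) = U * diagonal (fun i => d i ^ n) *
          (Uᵀ * U) * diagonal d * Uᵀ := by
      simp only [Matrix.mul_assoc]
    rw [h5, h2, Matrix.mul_one, Matrix.mul_assoc U, diagonal_mul_diagonal]
    simp only [pow_succ]

theorem pow_mul_pow_le_add {s q : ℕ} (hq : q ≤ s) (hs : Even s) (a b : ℝ) :
    a ^ q * b ^ (s - q) ≤ a ^ s + b ^ s := by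
  have h1 : a ^ q * b ^ (s - q) ≤ |a| ^ q * |b| ^ (s - q) := by
    rw [← abs_pow, ← abs_pow, ← abs_mul]
    exact le_abs_self _
  refine h1.trans ?_
  rw [← hs.pow_abs a, ← hs.pow_abs b]
  rcases le_total |a| |b| with h | h
  · calc |a| ^ q * |b| ^ (s - q) ≤ |b| ^ q * |b| ^ (s - q) := by gcongr
      _ = |b| ^ s := by rw [← pow_add, Nat.add_sub_cancel' hq]
      _ ≤ _ := by have := pow_nonneg (abs_nonneg a) s; linarith
  · calc |a| ^ q * |b| ^ (s - q) ≤ |a| ^ q * |a| ^ (s - q) := by gcongr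
      _ = |a| ^ s := by rw [← pow_add, Nat.add_sub_cancel' hq]
      _ ≤ _ := by have := pow_nonneg (abs_nonneg b) s; linarith

theorem trace_mul_diagonal_mul_diagonal (C D : Matrix V V ℝ) (a b : V → ℝ) :
    trace (C * diagonal a * D * diagonal b) = ∑ i, ∑ j, C i j * D j i * (a j * b i) := by
  rw [trace]
  refine sum_congr rfl fun i _ => ?_
  rw [diag_apply, mul_diagonal, mul_apply, sum_mul]
  refine sum_congr rfl fun j _ => ?_
  rw [mul_diagonal]
  ring

/-- A trace form of the inequality between arithmetic and geometric means. -/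
theorem trace_mul_pow_mul_pow_le {B X Y : Matrix V V ℝ} (hB : Bᵀ = B) (hX : X.IsHermitian)
    (hY : Y.IsHermitian) {s q : ℕ} (hq : q ≤ s) (hs : Even s) :
    trace (B * X ^ q * B * Y ^ (s - q)) ≤ trace (B * B * X ^ s) + trace (B * B * Y ^ s) := by
  obtain ⟨U, d, hU, hU', hXp⟩ := exists_diagonalization hX
  obtain ⟨W, f, hW, hW', hYp⟩ := exists_diagonalization hY
  -- Writing `B` between the two eigenbases turns each trace into a sum with nonnegative
  -- coefficients `C i j ^ 2`, so the scalar inequality applies termwise.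
  set C : Matrix V V ℝ := Wᵀ * B * U with hC
  have hCt : Cᵀ = Uᵀ * B * W := by
    simp [hC, transpose_mul, hB, Matrix.mul_assoc]
  have key : ∀ a b : ℕ, trace (B * X ^ a * B * Y ^ b) =
      ∑ i, ∑ j, C i j ^ 2 * (d j ^ a * f i ^ b) := by
    intro a b
    have h1 : trace (B * X ^ a * B * Y ^ b) =
        trace (C * diagonal (fun i => d i ^ a) * Cᵀ * diagonal (fun i => f i ^ b)) := by
      rw [hXp, hYp, hCt, hC]
      have h2 : B * (U * diagonal (fun i => d i ^ a) * Uᵀ) * B *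
          (W * diagonal (fun i => f i ^ b) * Wᵀ) =
          (B * U * diagonal (fun i => d i ^ a) * Uᵀ * B * W * diagonal (fun i => f i ^ b)) * Wᵀ := by
        simp only [Matrix.mul_assoc]
      rw [h2, trace_mul_comm]
      simp only [Matrix.mul_assoc]
    rw [h1, trace_mul_diagonal_mul_diagonal]
    refine sum_congr rfl fun i _ => sum_congr rfl fun j _ => ?_
    rw [transpose_apply]
    ring
  have hXs : trace (B * B * X ^ s) = trace (B * X ^ s * B * Y ^ 0) := by
    rw [pow_zero, Matrix.mul_one, Matrix.mul_assoc, trace_mul_comm]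
  have hYs : trace (B * B * Y ^ s) = trace (B * X ^ 0 * B * Y ^ s) := by
    rw [pow_zero, Matrix.mul_one]
  rw [hXs, hYs, key, key, key, ← sum_add_distrib]
  refine sum_le_sum fun i _ => ?_
  rw [← sum_add_distrib]
  refine sum_le_sum fun j _ => ?_
  rw [pow_zero, pow_zero, mul_one, one_mul, ← mul_add]
  exact mul_le_mul_of_nonneg_left (pow_mul_pow_le_add hq hs _ _) (sq_nonneg _)

/-- A symmetric matrix that is not at most `τ` has a large even power trace. -/
theorem pow_le_trace_pow {X : Matrix V V ℝ} (hX : X.IsHermitian) {τ : ℝ} (hτ : 0 ≤ τ)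
    (h : ¬ (τ • (1 : Matrix V V ℝ) - X).PosSemidef) {s : ℕ} (hs : Even s) :
    τ ^ s ≤ trace (X ^ s) := by
  obtain ⟨U, d, hU, hU', hXp⟩ := exists_diagonalization hX
  have h1 : trace (X ^ s) = ∑ i, d i ^ s := by
    rw [hXp, Matrix.mul_assoc, trace_mul_comm, Matrix.mul_assoc, hU', Matrix.mul_one,
      trace_diagonal]
  obtain ⟨i, hi⟩ : ∃ i, τ < d i := by
    by_contra hcon
    push Not at hcon
    refine h ?_
    have h2 : τ • (1 : Matrix V V ℝ) - X = U * diagonal (fun i => τ - d i) * Uᵀ := by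
      have h3 := hXp 1
      simp only [pow_one] at h3
      have h4 : diagonal (fun i => τ - d i) = τ • (1 : Matrix V V ℝ) - diagonal d := by
        rw [smul_one_eq_diagonal, diagonal_sub]
      rw [h4, Matrix.mul_sub, Matrix.sub_mul, ← h3, Matrix.mul_smul, Matrix.mul_one,
        Matrix.smul_mul, hU]
    rw [h2]
    have h5 : (diagonal fun i => τ - d i).PosSemidef :=
      PosSemidef.diagonal fun i => sub_nonneg.2 (hcon i)
    exact h5.mul_mul_conjTranspose_same U
  rw [h1]
  refine le_trans (pow_le_pow_left₀ hτ hi.le s) ?_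
  exact single_le_sum (f := fun i => d i ^ s) (fun j _ => hs.pow_nonneg _) (mem_univ i)

end TraceInequality

/-! ### Matrix Khintchine inequality by exchangeable pairs. -/

section Khintchine

variable {V I Ω : Type*} [Fintype V] [DecidableEq V] [Fintype I] [DecidableEq I] [Fintype Ω]
  [Nonempty Ω]

/-- A random linear combination of matrices. -/
def randomSum (g : Ω → ℝ) (B : I → Matrix V V ℝ) (P : I → Ω) : Matrix V V ℝ :=
  ∑ v, g (P v) • B v

theorem randomSum_sub_update (g : Ω → ℝ) (B : I → Matrix V V ℝ) (P : I → Ω) (v : I) (c : Ω) :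
    randomSum g B P - randomSum g B (Function.update P v c) = (g (P v) - g c) • B v := by
  rw [randomSum, randomSum, ← sum_sub_distrib, sum_eq_single v]
  · rw [Function.update_self, sub_smul]
  · intro w _ hw
    rw [Function.update_of_ne hw, sub_self]
  · simp

theorem transpose_randomSum (g : Ω → ℝ) {B : I → Matrix V V ℝ} (hB : ∀ v, (B v)ᵀ = B v)
    (P : I → Ω) : (randomSum g B P)ᵀ = randomSum g B P := by
  simp [randomSum, transpose_sum, hB]

theorem isHermitian_randomSum (g : Ω → ℝ) {B : I → Matrix V V ℝ} (hB : ∀ v, (B v)ᵀ = B v)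
    (P : I → Ω) : (randomSum g B P).IsHermitian := by
  rw [IsHermitian, conjTranspose_eq_transpose_of_trivial, transpose_randomSum g hB]

/-- The left side is the sum of squared norms of `B v` applied to the columns of `X ^ p`, so `hσ` is
used column by column. -/
theorem sum_trace_mul_pow_le {B : I → Matrix V V ℝ} (hB : ∀ v, (B v)ᵀ = B v) {σ : ℝ}
    (hσ : ∀ x : V → ℝ, ∑ v, ∑ u, (B v *ᵥ x) u ^ 2 ≤ σ * ∑ u, x u ^ 2)
    {X : Matrix V V ℝ} (hX : Xᵀ = X) (p : ℕ) :
    ∑ v, trace (B v * B v * X ^ (2 * p)) ≤ σ * trace (X ^ (2 * p)) := by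
  set N := X ^ p with hN
  have hNt : Nᵀ = N := by rw [hN, transpose_pow, hX]
  have h2 : X ^ (2 * p) = N * N := by rw [hN, ← pow_add, two_mul]
  have h3 : ∀ C : Matrix V V ℝ, Cᵀ = C →
      trace (C * C * (N * N)) = ∑ j, ∑ u, (C *ᵥ fun w => N w j) u ^ 2 := by
    intro C hC
    have h4 : trace (C * C * (N * N)) = trace ((C * N) * (C * N)ᵀ) := by
      rw [transpose_mul, hC, hNt, Matrix.mul_assoc, trace_mul_comm]
      simp only [Matrix.mul_assoc]
    rw [h4, trace, sum_comm]
    refine sum_congr rfl fun u _ => ?_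
    rw [diag_apply, mul_apply]
    refine sum_congr rfl fun j _ => ?_
    rw [transpose_apply, ← sq]
    rfl
  have h5 : trace (N * N) = ∑ j, ∑ u, N u j ^ 2 := by
    rw [trace, sum_comm]
    refine sum_congr rfl fun u _ => ?_
    rw [diag_apply, mul_apply]
    refine sum_congr rfl fun j _ => ?_
    rw [sq]
    have h6 : N j u = N u j := congrFun (congrFun hNt u) j
    rw [h6]
  rw [h2, sum_congr rfl fun v _ => h3 (B v) (hB v), sum_comm, h5, mul_sum]
  exact sum_le_sum fun j _ => hσ _

/-- One step of the moment recursion in the matrix Khintchine inequality. -/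
theorem expect_trace_pow_succ_le {g : Ω → ℝ} (hg : 𝔼 c, g c = 0) (hg1 : ∀ c, |g c| ≤ 1)
    {B : I → Matrix V V ℝ} (hB : ∀ v, (B v)ᵀ = B v) {σ : ℝ}
    (hσ : ∀ x : V → ℝ, ∑ v, ∑ u, (B v *ᵥ x) u ^ 2 ≤ σ * ∑ u, x u ^ 2) (p : ℕ) :
    𝔼 P : I → Ω, trace (randomSum g B P ^ (2 * (p + 1))) ≤
      4 * (2 * p + 1) * σ * 𝔼 P : I → Ω, trace (randomSum g B P ^ (2 * p)) := by
  set M := randomSum g B with hM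
  have hstep : ∀ v, 𝔼 P : I → Ω, g (P v) * trace (B v * M P ^ (2 * p + 1)) ≤
      4 * (2 * p + 1) * 𝔼 P : I → Ω, trace (B v * B v * M P ^ (2 * p)) := by
    intro v
    set F : (I → Ω) → ℝ := fun P => trace (B v * M P ^ (2 * p + 1)) with hF
    have h1 : 𝔼 P : I → Ω, g (P v) * F P =
        𝔼 P : I → Ω, 𝔼 c, (g (P v) - g c) * F P := by
      refine Finset.expect_congr rfl fun P _ => ?_
      rw [← Finset.expect_mul, Finset.expect_sub_distrib, hg, Fintype.expect_const, sub_zero]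
    have h2 : 𝔼 P : I → Ω, 𝔼 c, (g (P v) - g c) * F P =
        𝔼 P : I → Ω, 𝔼 c, (g c - g (P v)) * F (Function.update P v c) := by
      rw [expect_resample_swap v]
      simp only [Function.update_self]
    -- Antisymmetrising over the exchangeable pair formed by `P` and its resampling at `v` replaces
    -- `F` by a difference, which supplies a second factor `B v`.
    have h3 : 𝔼 P : I → Ω, 𝔼 c, (g (P v) - g c) * (F P - F (Function.update P v c)) =
        2 * 𝔼 P : I → Ω, g (P v) * F P := by
      have : ∀ P : I → Ω, ∀ c, (g (P v) - g c) * (F P - F (Function.update P v c)) =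
          (g (P v) - g c) * F P + (g c - g (P v)) * F (Function.update P v c) := by
        intro P c; ring
      simp_rw [this, Finset.expect_add_distrib]
      rw [← h2, ← h1]
      ring
    have h4 : ∀ P c, (g (P v) - g c) * (F P - F (Function.update P v c)) ≤
        4 * (2 * p + 1) * (trace (B v * B v * M P ^ (2 * p)) +
          trace (B v * B v * M (Function.update P v c) ^ (2 * p))) := by
      intro P c
      set X := M P
      set Y := M (Function.update P v c)
      have hXY : X - Y = (g (P v) - g c) • B v := randomSum_sub_update g B P v c
      have h5 : F P - F (Function.update P v c) =
          (g (P v) - g c) * ∑ q ∈ range (2 * p + 1), trace (B v * X ^ q * B v * Y ^ (2 * p - q)) := by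
        simp only [hF]
        rw [← trace_sub, ← Matrix.mul_sub, pow_sub_pow_eq_sum, hXY, Finset.mul_sum, trace_sum,
          Finset.mul_sum]
        refine sum_congr rfl fun q _ => ?_
        rw [Nat.add_sub_cancel, Matrix.mul_smul, Matrix.smul_mul, Matrix.mul_smul, trace_smul,
          smul_eq_mul]
        simp only [Matrix.mul_assoc]
        rfl
      have hXh : X.IsHermitian := isHermitian_randomSum g hB _
      have hYh : Y.IsHermitian := isHermitian_randomSum g hB _
      set Z := trace (B v * B v * X ^ (2 * p)) + trace (B v * B v * Y ^ (2 * p)) with hZ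
      have h6 : ∑ q ∈ range (2 * p + 1), trace (B v * X ^ q * B v * Y ^ (2 * p - q)) ≤
          (2 * p + 1) * Z := by
        have : ∀ q ∈ range (2 * p + 1), trace (B v * X ^ q * B v * Y ^ (2 * p - q)) ≤ Z :=
          fun q hq => trace_mul_pow_mul_pow_le (hB v) hXh hYh
            (Nat.lt_succ_iff.1 (mem_range.1 hq)) (even_two_mul p)
        refine (sum_le_sum this).trans (le_of_eq ?_)
        rw [sum_const, card_range, nsmul_eq_mul]
        push_cast
        ring
      have h7 : 0 ≤ Z := by
        have hn : ∀ X' : Matrix V V ℝ, X'.IsHermitian →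
            0 ≤ trace (B v * B v * X' ^ (2 * p)) := by
          intro X' hX'
          have ht : (X' ^ p)ᵀ = X' ^ p := by
            rw [transpose_pow, ← conjTranspose_eq_transpose_of_trivial, hX'.eq]
          have : B v * B v * X' ^ (2 * p) = B v * (B v * X' ^ p * X' ^ p) := by
            rw [two_mul, pow_add]; simp only [Matrix.mul_assoc]
          rw [this, trace_mul_comm]
          have h8 : B v * X' ^ p * X' ^ p * B v = (B v * X' ^ p) * (B v * X' ^ p)ᵀ := by
            rw [transpose_mul, hB, ht]; simp only [Matrix.mul_assoc]
          rw [h8, trace]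
          refine sum_nonneg fun i _ => ?_
          rw [diag_apply, mul_apply]
          exact sum_nonneg fun j _ => by rw [transpose_apply]; exact mul_self_nonneg _
        exact add_nonneg (hn X hXh) (hn Y hYh)
      rw [h5, ← mul_assoc, ← sq]
      have h8 : (g (P v) - g c) ^ 2 ≤ 4 := by
        have a1 := abs_le.1 (hg1 (P v))
        have a2 := abs_le.1 (hg1 c)
        nlinarith
      calc (g (P v) - g c) ^ 2 *
            ∑ q ∈ range (2 * p + 1), trace (B v * X ^ q * B v * Y ^ (2 * p - q))
          ≤ (g (P v) - g c) ^ 2 * ((2 * p + 1) * Z) :=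
            mul_le_mul_of_nonneg_left h6 (sq_nonneg _)
        _ ≤ 4 * ((2 * p + 1) * Z) := mul_le_mul_of_nonneg_right h8 (by positivity)
        _ = _ := by ring
    have h9 := expect_mono fun P => expect_mono (h4 P)
    rw [h3] at h9
    simp_rw [← Finset.mul_expect, Finset.expect_add_distrib] at h9
    rw [← expect_resample v fun P => trace (B v * B v * M P ^ (2 * p))] at h9
    simp_rw [Fintype.expect_const] at h9
    linarith
  have h1 : ∀ P : I → Ω, trace (M P ^ (2 * (p + 1))) =
      ∑ v, g (P v) * trace (B v * M P ^ (2 * p + 1)) := by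
    intro P
    have : M P ^ (2 * (p + 1)) = ∑ v, g (P v) • (B v * M P ^ (2 * p + 1)) := by
      rw [show 2 * (p + 1) = (2 * p + 1) + 1 by ring, pow_succ']
      conv_lhs => rw [hM, randomSum, Finset.sum_mul]
      simp only [Matrix.smul_mul]
      rfl
    rw [this, trace_sum]
    simp only [trace_smul, smul_eq_mul]
  simp_rw [h1]
  rw [Finset.expect_sum_comm]
  refine (sum_le_sum fun v _ => hstep v).trans ?_
  rw [← mul_sum, ← Finset.expect_sum_comm, mul_assoc (4 * (2 * (p : ℝ) + 1))]
  refine mul_le_mul_of_nonneg_left ?_ (by positivity : (0 : ℝ) ≤ 4 * (2 * p + 1))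
  rw [Finset.mul_expect]
  exact expect_mono fun P => sum_trace_mul_pow_le hB hσ (transpose_randomSum g hB P) p

/-- Matrix Khintchine inequality for even moments. -/
theorem expect_trace_pow_le {g : Ω → ℝ} (hg : 𝔼 c, g c = 0) (hg1 : ∀ c, |g c| ≤ 1)
    {B : I → Matrix V V ℝ} (hB : ∀ v, (B v)ᵀ = B v) {σ : ℝ} (hσ0 : 0 ≤ σ)
    (hσ : ∀ x : V → ℝ, ∑ v, ∑ u, (B v *ᵥ x) u ^ 2 ≤ σ * ∑ u, x u ^ 2) (p : ℕ) :
    𝔼 P : I → Ω, trace (randomSum g B P ^ (2 * p)) ≤ (8 * p * σ) ^ p * Fintype.card V := by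
  -- The recursion factor `4 * (2 * j + 1)` is at most `8 * p` for every `j < p`, so one uniform
  -- factor serves all steps.
  have h : ∀ j ≤ p, 𝔼 P : I → Ω, trace (randomSum g B P ^ (2 * j)) ≤
      (8 * p * σ) ^ j * Fintype.card V := by
    intro j
    induction j with
    | zero => intro _; simp
    | succ j ih =>
      intro hj
      refine (expect_trace_pow_succ_le hg hg1 hB hσ j).trans ?_
      have h1 := ih (by omega)
      have h2 : (j : ℝ) + 1 ≤ p := by exact_mod_cast hj
      rw [pow_succ, mul_comm (_ ^ j), mul_assoc (8 * (p : ℝ) * σ)]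
      have h3 : 4 * (2 * (j : ℝ) + 1) * σ ≤ 8 * p * σ :=
        mul_le_mul_of_nonneg_right (by linarith) hσ0
      exact (mul_le_mul_of_nonneg_left h1 (by positivity)).trans
        (mul_le_mul_of_nonneg_right h3 (by positivity))
  exact h p le_rfl

end Khintchine

/-! ### Test matrices from graphs and from triple systems. -/

section TestGraphs

variable {V : Type*} [Fintype V] [DecidableEq V] {k : ℕ}

theorem expect_sum_freeWeight_mul (E : Finset (Finset V)) (M : (V → Fin k) → V → V → ℝ) :
    𝔼 P, ∑ u, ∑ x, freeWeight E P u x * M P u x =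
      ∑ e ∈ E, ∑ u, ∑ x, 𝔼 P, edgeWeight P e u x * M P u x := by
  have h1 : ∀ P : V → Fin k, ∑ u, ∑ x, freeWeight E P u x * M P u x =
      ∑ e ∈ E, ∑ u, ∑ x, edgeWeight P e u x * M P u x := by
    intro P
    simp only [freeWeight, sum_mul]
    rw [sum_comm]
    simp_rw [sum_comm (s := E)]
    rw [sum_comm]
  simp_rw [h1, Finset.expect_sum_comm]

/-- Surplus from a bounded degree graph on the vertices such that many edges contain an adjacent
pair. -/
theorem surplus_of_pairs (E : Finset (Finset V)) {r : ℕ} (hE : ∀ e ∈ E, #e = r)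
    (hE0 : E.Nonempty) (hk : 3 ≤ k) (hkr : k ≤ r) (hrk : r ≤ k + 1) {s : ℝ}
    (hs : ∀ P : V → Fin k, (cutCount E P : ℝ) ≤ baseline E r k + s)
    (F : V → V → Prop) [DecidableRel F] (hsymm : ∀ u x, F u x → F x u) (hirr : ∀ u, ¬ F u u)
    {ρ : ℝ} (hρ : 0 < ρ) (hdeg : ∀ u, (#{x | F u x} : ℝ) ≤ ρ) :
    (#{e ∈ E | ∃ u ∈ e, ∃ x ∈ e, F u x} : ℝ) * (1 / ρ * (1 / 8 / (k : ℝ) ^ r)) /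
      (4 * (1 + Real.log #E)) ≤ (1 + (r : ℝ) ^ 2 * (k : ℝ) ^ r) * s := by
  set A : Matrix V V ℝ := Matrix.of fun u x => if F u x then (1 / ρ) else 0 with hA
  have hAuv : ∀ u x, A u x = if F u x then (1 / ρ) else 0 := fun _ _ => rfl
  have hA0 : ∀ u x, 0 ≤ A u x := by
    intro u x
    rw [hAuv]
    split_ifs <;> positivity
  have hAsymm : ∀ u x, A u x = A x u := by
    intro u x
    rw [hAuv, hAuv]
    exact if_congr ⟨hsymm u x, hsymm x u⟩ rfl rfl
  have hrow : ∀ u, ∑ x, A u x ≤ 1 := by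
    intro u
    simp only [hAuv]
    rw [← sum_filter, sum_const, nsmul_eq_mul, mul_one_div, div_le_one hρ]
    exact hdeg u
  have hpsd : (1 - A).PosSemidef := by
    refine PosSemidef.of_dotProduct_mulVec_nonneg ?_ fun y => ?_
    · rw [IsHermitian, conjTranspose_eq_transpose_of_trivial, transpose_sub, transpose_one]
      congr 1
      ext u x
      exact hAsymm x u
    -- Use `2ab ≤ a ^ 2 + b ^ 2` on each entry together with row sums at most 1.
    · have h1 : ∑ u, ∑ x, A u x * (y u * y x) ≤ ∑ u, y u ^ 2 := by
        have h2 : ∑ u, ∑ x, A u x * (y u * y x) ≤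
            ∑ u, ∑ x, (A u x * y u ^ 2 / 2 + A u x * y x ^ 2 / 2) := by
          refine sum_le_sum fun u _ => sum_le_sum fun x _ => ?_
          nlinarith [mul_nonneg (hA0 u x) (sq_nonneg (y u - y x))]
        have h3 : ∑ u, ∑ x, A u x * y u ^ 2 / 2 ≤ ∑ u, y u ^ 2 / 2 := by
          refine sum_le_sum fun u _ => ?_
          rw [← sum_div, ← sum_mul]
          have := mul_le_mul_of_nonneg_right (hrow u) (sq_nonneg (y u))
          linarith
        have h4 : ∑ u, ∑ x, A u x * y x ^ 2 / 2 = ∑ u, ∑ x, A u x * y u ^ 2 / 2 := by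
          rw [sum_comm]
          exact sum_congr rfl fun u _ => sum_congr rfl fun x _ => by rw [hAsymm]
        simp only [sum_add_distrib] at h2
        rw [h4] at h2
        rw [← sum_div] at h3
        linarith
      have h5 : star y ⬝ᵥ ((1 - A) *ᵥ y) = ∑ u, y u ^ 2 - ∑ u, ∑ x, A u x * (y u * y x) := by
        rw [sub_mulVec, one_mulVec, dotProduct_sub]
        simp only [dotProduct, mulVec, star_trivial, mul_sum]
        congr 1
        · exact sum_congr rfl fun u _ => (sq _).symm
        · exact sum_congr rfl fun u _ => sum_congr rfl fun x _ => by ring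
      rw [h5]
      linarith
  refine le_trans ?_ (expect_test_le_surplus E hE hE0 hk hkr hrk hs (fun _ => A)
    (fun _ u => by rw [hAuv, if_neg (hirr u)]) fun _ => hpsd)
  refine div_le_div_of_nonneg_right ?_ ?_
  swap
  · have : 0 ≤ Real.log #E := Real.log_natCast_nonneg _
    positivity
  rw [expect_sum_freeWeight_mul E fun _ => A]
  have hterm : ∀ e u x, 0 ≤ 𝔼 P : V → Fin k, edgeWeight P e u x * A u x := fun e u x =>
    expect_nonneg' fun P => mul_nonneg (edgeWeight_nonneg _ _ _ _) (hA0 u x)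
  calc (#{e ∈ E | ∃ u ∈ e, ∃ x ∈ e, F u x} : ℝ) * (1 / ρ * (1 / 8 / (k : ℝ) ^ r))
      = ∑ e ∈ E with ∃ u ∈ e, ∃ x ∈ e, F u x, (1 / ρ * (1 / 8 / (k : ℝ) ^ r)) := by
        rw [sum_const, nsmul_eq_mul]
    _ ≤ ∑ e ∈ E with ∃ u ∈ e, ∃ x ∈ e, F u x, ∑ u, ∑ x,
        𝔼 P : V → Fin k, edgeWeight P e u x * A u x := by
        refine sum_le_sum fun e he => ?_
        obtain ⟨heE, u, hu, x, hx, hF⟩ := mem_filter.1 he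
        have hux : u ≠ x := by rintro rfl; exact hirr _ hF
        have hcard := hE e heE
        refine le_trans ?_ (single_le_sum (fun u _ => sum_nonneg fun x _ => hterm e u x)
          (mem_univ u))
        refine le_trans ?_ (single_le_sum (fun x _ => hterm e u x) (mem_univ x))
        rw [← Finset.expect_mul, hAuv, if_pos hF, mul_comm]
        refine mul_le_mul_of_nonneg_right ?_ (by positivity)
        rw [← hcard]
        exact le_expect_edgeWeight hk (by omega) (by omega) hu hx hux
    _ ≤ _ := sum_le_sum_of_subset_of_nonneg (filter_subset _ _) fun e _ _ =>
        sum_nonneg fun u _ => sum_nonneg fun x _ => hterm e u x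

section Triples

/-- The adjacency matrices of the links of a triple system. -/
def linkMatrix (T : V → V → V → Prop) [∀ u x v, Decidable (T u x v)] (v : V) : Matrix V V ℝ :=
  Matrix.of fun u x => if T u x v then 1 else 0

variable (T : V → V → V → Prop) [∀ u x v, Decidable (T u x v)]

theorem linkMatrix_apply (u x v : V) : linkMatrix T v u x = if T u x v then 1 else 0 := rfl

theorem linkMatrix_nonneg (u x v : V) : 0 ≤ linkMatrix T v u x := by
  rw [linkMatrix_apply]
  split_ifs <;> norm_num

theorem linkMatrix_le_one (u x v : V) : linkMatrix T v u x ≤ 1 := by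
  rw [linkMatrix_apply]
  split_ifs <;> norm_num

theorem transpose_linkMatrix (hsymm : ∀ u x v, T u x v → T x u v) (v : V) :
    (linkMatrix T v)ᵀ = linkMatrix T v := by
  ext u x
  rw [transpose_apply, linkMatrix_apply, linkMatrix_apply]
  exact if_congr ⟨hsymm _ _ _, hsymm _ _ _⟩ rfl rfl

/-- By Cauchy–Schwarz a row with at most `D₂` ones costs a factor `D₂`; each `y x ^ 2` is then
counted at most `D₁` times. This is the variance parameter `σ` for Khintchine. -/
theorem sum_linkMatrix_mulVec_sq_le {D₁ D₂ : ℝ} (hD₂0 : 0 ≤ D₂)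
    (hD₂ : ∀ u v, (#{x | T u x v} : ℝ) ≤ D₂)
    (hD₁ : ∀ x, ∑ v, (#{u | T u x v} : ℝ) ≤ D₁) (y : V → ℝ) :
    ∑ v, ∑ u, (linkMatrix T v *ᵥ y) u ^ 2 ≤ D₁ * D₂ * ∑ u, y u ^ 2 := by
  have hsq : ∀ v u x, linkMatrix T v u x ^ 2 = linkMatrix T v u x := by
    intro v u x
    rw [linkMatrix_apply]
    split_ifs <;> norm_num
  have h1 : ∀ v u, (linkMatrix T v *ᵥ y) u ^ 2 ≤ D₂ * ∑ x, linkMatrix T v u x * y x ^ 2 := by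
    intro v u
    have h2 : (linkMatrix T v *ᵥ y) u = ∑ x, linkMatrix T v u x * (linkMatrix T v u x * y x) := by
      refine sum_congr rfl fun x _ => ?_
      rw [← mul_assoc, ← sq, hsq]
    rw [h2]
    refine (sum_mul_sq_le_sq_mul_sq _ _ _).trans ?_
    simp only [mul_pow, hsq]
    refine mul_le_mul_of_nonneg_right ?_
      (sum_nonneg fun x _ => mul_nonneg (linkMatrix_nonneg T u x v) (sq_nonneg _))
    simp only [linkMatrix_apply]
    rw [sum_boole]
    exact hD₂ u v
  calc ∑ v, ∑ u, (linkMatrix T v *ᵥ y) u ^ 2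
      ≤ ∑ v, ∑ u, D₂ * ∑ x, linkMatrix T v u x * y x ^ 2 :=
        sum_le_sum fun v _ => sum_le_sum fun u _ => h1 v u
    _ = D₂ * ∑ x, (∑ v, ∑ u, linkMatrix T v u x) * y x ^ 2 := by
        simp only [← mul_sum, sum_mul]
        congr 1
        rw [sum_congr rfl fun v _ => sum_comm, sum_comm]
    _ ≤ D₂ * ∑ x, D₁ * y x ^ 2 := by
        refine mul_le_mul_of_nonneg_left (sum_le_sum fun x _ => ?_) hD₂0
        refine mul_le_mul_of_nonneg_right ?_ (sq_nonneg _)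
        simp only [linkMatrix_apply, sum_boole]
        exact hD₁ x
    _ = _ := by rw [← mul_sum]; ring

/-- Nonnegativity of every term rules out cancellation: one triple per edge suffices for a lower
bound on the correlation. -/
theorem expect_link_mul_edgeWeight_nonneg (hk : 3 ≤ k)
    (hne : ∀ u x v, T u x v → u ≠ x ∧ v ≠ u ∧ v ≠ x) {e : Finset V} (hke : k ≤ #e)
    (hek : #e ≤ k + 1) (u x v : V) :
    0 ≤ linkMatrix T v u x * 𝔼 P : V → Fin k, edgeWeight P e u x * balance (P v) := by
  by_cases hT : T u x v
  swap
  · rw [linkMatrix_apply, if_neg hT, zero_mul]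
  refine mul_nonneg (linkMatrix_nonneg T u x v) ?_
  by_cases hv : v ∈ e
  swap
  · rw [expect_edgeWeight_mul_balance_of_notMem hk hv]
  by_cases hux : u ∈ e ∧ x ∈ e
  · obtain ⟨h1, h2, h3⟩ := hne u x v hT
    exact le_trans (by positivity)
      (le_expect_edgeWeight_mul_balance hk hke hek hux.1 hux.2 hv h1 h2 h3)
  · have : ∀ P : V → Fin k, edgeWeight P e u x = 0 := by
      intro P
      refine if_neg fun h => hux ?_
      exact ⟨(mem_filter.1 h.2.1).1, (mem_filter.1 h.2.2.1).1⟩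
    simp [this]

/-- Surplus from a triple system with bounded degrees such that many edges contain a triple. -/
theorem surplus_of_triples (E : Finset (Finset V)) {r : ℕ} (hE : ∀ e ∈ E, #e = r)
    (hE2 : 2 ≤ #E) (hV : Fintype.card V ≤ r * #E) (hk : 3 ≤ k) (hkr : k ≤ r) (hrk : r ≤ k + 1)
    {s : ℝ} (hs : ∀ P : V → Fin k, (cutCount E P : ℝ) ≤ baseline E r k + s)
    (hsymm : ∀ u x v, T u x v → T x u v) (hne : ∀ u x v, T u x v → u ≠ x ∧ v ≠ u ∧ v ≠ x)
    {D₁ D₂ : ℝ} (hD₁1 : 1 ≤ D₁) (hD₂1 : 1 ≤ D₂)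
    (hD₂ : ∀ u v, (#{x | T u x v} : ℝ) ≤ D₂) (hD₁ : ∀ x, ∑ v, (#{u | T u x v} : ℝ) ≤ D₁) :
    (#{e ∈ E | ∃ u ∈ e, ∃ x ∈ e, ∃ v ∈ e, T u x v} : ℝ) * (1 / (4 * (k : ℝ) ^ 2) / (k : ℝ) ^ r) /
      (√(72 * (1 + Real.log #E) * (D₁ * D₂)) * (4 * (1 + Real.log #E))) ≤
        (1 + ((r : ℝ) ^ 2 + (r : ℝ) ^ 4) * (k : ℝ) ^ r) * s := by
  have : NeZero k := ⟨by omega⟩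
  have hE0 : E.Nonempty := card_pos.1 (by omega)
  set m : ℝ := ((#E : ℕ) : ℝ) with hm
  have hm2 : (2 : ℝ) ≤ m := by rw [hm]; exact_mod_cast hE2
  set L := Real.log m with hL
  have hL0 : 0 ≤ L := Real.log_nonneg (by linarith)
  set σ := D₁ * D₂ with hσ
  have hσ1 : 1 ≤ σ := by nlinarith
  set τ := √(72 * (1 + L) * σ) with hτ
  have hτ2 : τ ^ 2 = 72 * (1 + L) * σ := Real.sq_sqrt (by positivity)
  have hτ1 : 1 ≤ τ := Real.one_le_sqrt.2 (by nlinarith)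
  have hτ0 : 0 < τ := by linarith
  set B := linkMatrix T with hB
  have hBt : ∀ v, (B v)ᵀ = B v := transpose_linkMatrix T hsymm
  set M : (V → Fin k) → Matrix V V ℝ := randomSum balance B with hM
  have hMuv : ∀ P u x, M P u x = ∑ v, balance (P v) * B v u x := by
    intro P u x
    simp [hM, randomSum, Matrix.sum_apply]
  have hM0 : ∀ P u, M P u u = 0 := by
    intro P u
    rw [hMuv]
    refine sum_eq_zero fun v _ => ?_
    rw [hB, linkMatrix_apply, if_neg fun h => (hne u u v h).1 rfl, mul_zero]
  have hn : (Fintype.card V : ℝ) ≤ r * m := by rw [hm]; exact_mod_cast hV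
  have hMabs : ∀ P u x, M P u x ≤ r * m := by
    intro P u x
    rw [hMuv]
    refine le_trans (sum_le_sum (g := fun _ => (1 : ℝ)) fun v _ => ?_)
      (le_trans (le_of_eq ?_) hn)
    · have h1 := abs_le.1 (abs_balance_le hk (P v))
      have h2 := linkMatrix_nonneg T u x v
      have h3 := linkMatrix_le_one T u x v
      change balance (P v) * linkMatrix T v u x ≤ 1
      nlinarith
    · simp
  let good : (V → Fin k) → Prop := fun P => (τ • (1 : Matrix V V ℝ) - M P).PosSemidef
  classical
  -- the probability that the test matrix is too large
  obtain ⟨p, hp1, hp2⟩ : ∃ p : ℕ, 3 * L ≤ p ∧ (p : ℝ) ≤ 3 * L + 1 :=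
    ⟨⌈3 * L⌉₊, Nat.le_ceil _, (Nat.ceil_lt_add_one (by positivity)).le⟩
  -- Markov's inequality for the trace of the power `2p`. Since `p ≤ 3L + 1` and `e ≤ 3`, we have
  -- `8pσe ≤ 72(1 + L)σ = τ ^ 2`, so the failure probability is at most `e ^ (-p)` times the
  -- dimension.
  have hbad : 𝔼 P : V → Fin k, (if good P then (0 : ℝ) else 1) ≤ r * m * Real.exp (-(3 * L)) := by
    have h1 : 𝔼 P : V → Fin k, (if good P then (0 : ℝ) else 1) * τ ^ (2 * p) ≤
        𝔼 P : V → Fin k, trace (M P ^ (2 * p)) := by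
      refine expect_mono fun P => ?_
      split_ifs with hg
      · rw [zero_mul, pow_mul']
        have h2 : M P ^ p * M P ^ p = (M P ^ p) * (M P ^ p)ᵀ := by
          rw [transpose_pow, transpose_randomSum _ hBt]
        rw [sq, h2, trace]
        refine sum_nonneg fun i _ => ?_
        rw [diag_apply, mul_apply]
        exact sum_nonneg fun j _ => by rw [transpose_apply]; exact mul_self_nonneg _
      · rw [one_mul]
        exact pow_le_trace_pow (isHermitian_randomSum _ hBt P) hτ0.le hg (even_two_mul p)
    have h2 := h1.trans (expect_trace_pow_le (expect_balance hk) (abs_balance_le hk) hBt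
      (by positivity : 0 ≤ σ)
      (sum_linkMatrix_mulVec_sq_le T (by linarith) hD₂ hD₁) p)
    rw [← Finset.expect_mul] at h2
    have h3 : (8 * p * σ) ^ p * Real.exp p ≤ τ ^ (2 * p) := by
      rw [pow_mul, hτ2, ← Real.exp_one_pow, ← mul_pow]
      refine pow_le_pow_left₀ (by positivity) ?_ p
      have he : Real.exp 1 ≤ 3 := Real.exp_one_lt_three.le
      calc 8 * p * σ * Real.exp 1 ≤ 8 * p * σ * 3 := by gcongr
        _ ≤ 8 * (3 * L + 1) * σ * 3 := by gcongr
        _ ≤ 72 * (1 + L) * σ := by nlinarith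
    have hτp : 0 < τ ^ (2 * p) := by positivity
    have h4 : 𝔼 P : V → Fin k, (if good P then (0 : ℝ) else 1) ≤
        Real.exp (-p) * Fintype.card V := by
      refine le_of_mul_le_mul_right (h2.trans ?_) hτp
      calc (8 * p * σ) ^ p * Fintype.card V
          = (8 * p * σ) ^ p * Real.exp p * (Real.exp (-p) * Fintype.card V) := by
            rw [Real.exp_neg]; field_simp
        _ ≤ τ ^ (2 * p) * (Real.exp (-p) * Fintype.card V) := by gcongr
        _ = _ := mul_comm _ _
    refine h4.trans ?_
    rw [mul_comm]
    gcongr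
  -- the correlation with the test matrix
  have hmain : (#{e ∈ E | ∃ u ∈ e, ∃ x ∈ e, ∃ v ∈ e, T u x v} : ℝ) *
      (1 / (4 * (k : ℝ) ^ 2) / (k : ℝ) ^ r) ≤
        𝔼 P, ∑ u, ∑ x, freeWeight E P u x * M P u x := by
    rw [expect_sum_freeWeight_mul E M]
    have h1 : ∀ e u x, 𝔼 P, edgeWeight P e u x * M P u x =
        ∑ v, B v u x * 𝔼 P : V → Fin k, edgeWeight P e u x * balance (P v) := by
      intro e u x
      simp_rw [hMuv, mul_sum, Finset.expect_sum_comm, Finset.mul_expect]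
      exact sum_congr rfl fun v _ => Finset.expect_congr rfl fun P _ => by ring
    simp only [h1]
    have hterm : ∀ e ∈ E, ∀ u x v,
        0 ≤ B v u x * 𝔼 P : V → Fin k, edgeWeight P e u x * balance (P v) := by
      intro e he u x v
      have := hE e he
      exact expect_link_mul_edgeWeight_nonneg T hk hne (by omega) (by omega) u x v
    rw [← nsmul_eq_mul, ← sum_const]
    refine le_trans (sum_le_sum fun e he => ?_)
      (sum_le_sum_of_subset_of_nonneg (filter_subset _ _) fun e he _ =>
        sum_nonneg fun u _ => sum_nonneg fun x _ => sum_nonneg fun v _ => hterm e he u x v)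
    obtain ⟨heE, u, hu, x, hx, v, hv, hT⟩ := mem_filter.1 he
    have hcard := hE e heE
    refine le_trans ?_ (single_le_sum (fun u _ => sum_nonneg fun x _ => sum_nonneg fun v _ =>
      hterm e heE u x v) (mem_univ u))
    refine le_trans ?_ (single_le_sum (fun x _ => sum_nonneg fun v _ =>
      hterm e heE u x v) (mem_univ x))
    refine le_trans ?_ (single_le_sum (fun v _ => hterm e heE u x v) (mem_univ v))
    rw [hB, linkMatrix_apply, if_pos hT, one_mul, ← hcard]
    obtain ⟨h1, h2, h3⟩ := hne u x v hT
    exact le_expect_edgeWeight_mul_balance hk (by omega) (by omega) hu hx hv h1 h2 h3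
  -- the truncated test matrix
  let M' : (V → Fin k) → Matrix V V ℝ := fun P => if good P then (1 / τ) • M P else 0
  have hM'0 : ∀ P u, M' P u u = 0 := by
    intro P u
    simp only [M']
    split_ifs
    · simp [hM0]
    · simp
  have hM'psd : ∀ P, (1 - M' P).PosSemidef := by
    intro P
    simp only [M']
    split_ifs with hg
    · have h1 : (1 : Matrix V V ℝ) - (1 / τ) • M P =
          (1 / τ) • (τ • (1 : Matrix V V ℝ) - M P) := by
        rw [smul_sub, smul_smul, one_div_mul_cancel hτ0.ne', one_smul]
      rw [h1]
      exact PosSemidef.smul hg (by positivity)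
    · rw [sub_zero]
      exact PosSemidef.one
  have htest := expect_test_le_surplus E hE hE0 hk hkr hrk hs M' hM'0 hM'psd
  -- Discarding the bad event loses at most its probability `r m e ^ (-3L)` times total weight `r ^
  -- 2 m` times the entry bound `r m`, that is `r ^ 4` before the factor `1 / τ`.
  have hcmp : 1 / τ * (𝔼 P, ∑ u, ∑ x, freeWeight E P u x * M P u x - (r : ℝ) ^ 4) ≤
      𝔼 P, ∑ u, ∑ x, freeWeight E P u x * M' P u x := by
    have h1 : ∀ P, 1 / τ * (∑ u, ∑ x, freeWeight E P u x * M P u x -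
        (if good P then (0 : ℝ) else 1) * ((r : ℝ) ^ 2 * m * (r * m))) ≤
          ∑ u, ∑ x, freeWeight E P u x * M' P u x := by
      intro P
      by_cases hg : good P
      · simp only [M', hg, if_true, zero_mul, sub_zero, mul_sum]
        refine le_of_eq (sum_congr rfl fun u _ => sum_congr rfl fun x _ => ?_)
        rw [Matrix.smul_apply, smul_eq_mul]
        ring
      · simp only [M', hg, if_false, one_mul, Matrix.zero_apply, mul_zero, sum_const_zero]
        refine mul_nonpos_of_nonneg_of_nonpos (by positivity) (sub_nonpos.2 ?_)
        calc ∑ u, ∑ x, freeWeight E P u x * M P u x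
            ≤ ∑ u, ∑ x, freeWeight E P u x * (r * m) :=
              sum_le_sum fun u _ => sum_le_sum fun x _ =>
                mul_le_mul_of_nonneg_left (hMabs P u x) (freeWeight_nonneg E P u x)
          _ = (∑ u, ∑ x, freeWeight E P u x) * (r * m) := by simp only [sum_mul]
          _ ≤ _ := mul_le_mul_of_nonneg_right (sum_freeWeight_le E hE P) (by positivity)
    refine le_trans ?_ (expect_mono h1)
    rw [← Finset.mul_expect, Finset.expect_sub_distrib, ← Finset.expect_mul]
    refine mul_le_mul_of_nonneg_left (sub_le_sub_left ?_ _) (by positivity)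
    have h2 : Real.exp (-(3 * L)) * m ^ 3 = 1 := by
      have : m ^ 3 = Real.exp (3 * L) := by
        rw [mul_comm, Real.exp_mul, hL, Real.exp_log (by linarith)]
        norm_cast
      rw [this, ← Real.exp_add]
      simp
    calc _ ≤ r * m * Real.exp (-(3 * L)) * ((r : ℝ) ^ 2 * m * (r * m)) :=
          mul_le_mul_of_nonneg_right hbad (by positivity)
      _ = (r : ℝ) ^ 4 * (Real.exp (-(3 * L)) * m ^ 3) := by ring
      _ = (r : ℝ) ^ 4 := by rw [h2, mul_one]
  have hsmall := one_div_pow_le_surplus E hE hE0 hk hkr hs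
  have hkp : (0 : ℝ) < (k : ℝ) ^ r := by positivity
  rw [div_le_iff₀ hkp] at hsmall
  set N : ℝ := (#{e ∈ E | ∃ u ∈ e, ∃ x ∈ e, ∃ v ∈ e, T u x v} : ℝ) *
      (1 / (4 * (k : ℝ) ^ 2) / (k : ℝ) ^ r) with hN
  have h4L : 1 ≤ 4 * (1 + L) := by linarith
  have h1 : 1 / τ * (N - (r : ℝ) ^ 4) / (4 * (1 + L)) ≤ (1 + (r : ℝ) ^ 2 * (k : ℝ) ^ r) * s := by
    refine le_trans (div_le_div_of_nonneg_right ?_ (by positivity)) htest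
    exact le_trans (mul_le_mul_of_nonneg_left (sub_le_sub_right hmain _) (by positivity)) hcmp
  have h2 : N / (τ * (4 * (1 + L))) = 1 / τ * (N - (r : ℝ) ^ 4) / (4 * (1 + L)) +
      (r : ℝ) ^ 4 / (τ * (4 * (1 + L))) := by
    field_simp
    ring
  have h3 : (r : ℝ) ^ 4 / (τ * (4 * (1 + L))) ≤ (r : ℝ) ^ 4 :=
    div_le_self (by positivity) (by nlinarith)
  have h4 : (r : ℝ) ^ 4 * 1 ≤ (r : ℝ) ^ 4 * (s * (k : ℝ) ^ r) :=
    mul_le_mul_of_nonneg_left hsmall (by positivity)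
  rw [h2]
  linarith

end Triples

end TestGraphs

/-! ### Degrees, codegrees, bad pairs and good triples. -/

section Degrees

variable {V : Type*} [Fintype V] [DecidableEq V] (E : Finset (Finset V))

/-- The degree of a vertex. -/
def deg (v : V) : ℕ := #{e ∈ E | v ∈ e}

/-- The codegree of a pair of vertices. -/
def codeg (u x : V) : ℕ := #{e ∈ E | u ∈ e ∧ x ∈ e}

theorem codeg_comm (u x : V) : codeg E u x = codeg E x u := by
  simp only [codeg, and_comm]

variable {E} {r : ℕ} (hE : ∀ e ∈ E, #e = r)

include hE in
theorem sum_deg : ∑ v, deg E v = r * #E := by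
  simp only [deg, card_filter]
  rw [sum_comm, sum_congr rfl fun e he => by
    rw [← card_filter, filter_mem_eq_inter, univ_inter, hE e he], sum_const, smul_eq_mul, mul_comm]

include hE in
theorem sum_codeg (u : V) : ∑ x, codeg E u x = r * deg E u := by
  have h : ∀ x, codeg E u x = deg {e ∈ E | u ∈ e} x := by
    intro x
    rw [codeg, deg, filter_filter]
  simp only [h]
  exact sum_deg fun e he => hE e (mem_filter.1 he).1

theorem card_mul_le_sum {ι : Type*} [Fintype ι] (f : ι → ℕ) {a : ℝ} :
    (#{i | a < f i} : ℝ) * a ≤ ((∑ i, f i : ℕ) : ℝ) := by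
  push_cast
  calc (#{i | a < f i} : ℝ) * a = ∑ i with a < f i, a := by rw [sum_const, nsmul_eq_mul]
    _ ≤ ∑ i with a < f i, (f i : ℝ) := sum_le_sum fun i hi => (mem_filter.1 hi).2.le
    _ ≤ ∑ i, (f i : ℝ) := sum_le_sum_of_subset_of_nonneg (filter_subset _ _)
        fun i _ _ => Nat.cast_nonneg _

variable (E)

/-- Two vertices of large degree, or two vertices of small degree and large codegree. -/
def BadPair (Δ₁ Δ₂ : ℝ) (u x : V) : Prop :=
  u ≠ x ∧ ((Δ₁ < deg E u ∧ Δ₁ < deg E x) ∨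
    (deg E u ≤ Δ₁ ∧ deg E x ≤ Δ₁ ∧ Δ₂ < codeg E u x))

/-- Three vertices of a common edge with small degrees and small codegrees. -/
def GoodTriple (Δ₁ Δ₂ : ℝ) (u x v : V) : Prop :=
  (u ≠ x ∧ v ≠ u ∧ v ≠ x) ∧ deg E x ≤ Δ₁ ∧ codeg E u v ≤ Δ₂ ∧ deg E u ≤ Δ₁ ∧ codeg E x v ≤ Δ₂ ∧
    ∃ e ∈ E, u ∈ e ∧ x ∈ e ∧ v ∈ e

variable {E}

theorem BadPair.symm {Δ₁ Δ₂ : ℝ} {u x : V} (h : BadPair E Δ₁ Δ₂ u x) :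
    BadPair E Δ₁ Δ₂ x u := by
  obtain ⟨hne, h | h⟩ := h
  · exact ⟨hne.symm, Or.inl h.symm⟩
  · exact ⟨hne.symm, Or.inr ⟨h.2.1, h.1, by rw [codeg_comm]; exact h.2.2⟩⟩

theorem GoodTriple.swap {Δ₁ Δ₂ : ℝ} {u x v : V} (h : GoodTriple E Δ₁ Δ₂ u x v) :
    GoodTriple E Δ₁ Δ₂ x u v := by
  obtain ⟨⟨h1, h2, h3⟩, h4, h5, h6, h7, e, he, h8, h9, h10⟩ := h
  exact ⟨⟨h1.symm, h3, h2⟩, h6, h7, h4, h5, e, he, h9, h8, h10⟩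

-- A heavy vertex forms bad pairs only with heavy vertices, of which there are at most `r * #E /
-- Δ₁`. A light vertex forms them only with vertices of large codegree, and its codegrees sum to at
-- most `r * Δ₁`. Mixed pairs are excluded from `BadPair` precisely to keep these degrees bounded.
open Classical in
include hE in
theorem card_badPair_le {Δ₁ Δ₂ ρ : ℝ} (hΔ₁ : 0 < Δ₁) (hΔ₂ : 0 < Δ₂) (h1 : r * #E / Δ₁ ≤ ρ)
    (h2 : r * Δ₁ / Δ₂ ≤ ρ) (u : V) : (#{x | BadPair E Δ₁ Δ₂ u x} : ℝ) ≤ ρ := by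
  by_cases hu : Δ₁ < deg E u
  · refine le_trans ?_ h1
    have hsub : ({x | BadPair E Δ₁ Δ₂ u x} : Finset V) ⊆ ({x | Δ₁ < deg E x} : Finset V) := by
      intro x hx
      rw [mem_filter] at hx ⊢
      obtain ⟨-, -, h | h⟩ := hx
      · exact ⟨mem_univ _, h.2⟩
      · exact absurd hu h.1.not_gt
    rw [le_div_iff₀ hΔ₁]
    have h3 := card_mul_le_sum (deg E) (a := Δ₁)
    rw [sum_deg hE] at h3
    push_cast at h3
    refine le_trans (mul_le_mul_of_nonneg_right ?_ hΔ₁.le) h3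
    exact_mod_cast card_le_card hsub
  · refine le_trans ?_ h2
    have hsub : ({x | BadPair E Δ₁ Δ₂ u x} : Finset V) ⊆ ({x | Δ₂ < codeg E u x} : Finset V) := by
      intro x hx
      rw [mem_filter] at hx ⊢
      obtain ⟨-, -, h | h⟩ := hx
      · exact absurd h.1 hu
      · exact ⟨mem_univ _, h.2.2⟩
    rw [le_div_iff₀ hΔ₂]
    have h3 := card_mul_le_sum (codeg E u) (a := Δ₂)
    rw [sum_codeg hE] at h3
    push_cast at h3
    have h4 : (r : ℝ) * deg E u ≤ r * Δ₁ :=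
      mul_le_mul_of_nonneg_left (not_lt.1 hu) (Nat.cast_nonneg _)
    refine le_trans (mul_le_mul_of_nonneg_right ?_ hΔ₂.le) (h3.trans h4)
    exact_mod_cast card_le_card hsub

-- Such an `x` lies in one of the at most `Δ₂` edges through `u` and `v`.
open Classical in
include hE in
theorem card_goodTriple_le {Δ₁ Δ₂ : ℝ} (hΔ₂ : 0 ≤ Δ₂) (u v : V) :
    (#{x | GoodTriple E Δ₁ Δ₂ u x v} : ℝ) ≤ r * Δ₂ := by
  by_cases hc : (codeg E u v : ℝ) ≤ Δ₂
  · have hsub : ({x | GoodTriple E Δ₁ Δ₂ u x v} : Finset V) ⊆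
        ({e ∈ E | u ∈ e ∧ v ∈ e} : Finset (Finset V)).biUnion id := by
      intro x hx
      obtain ⟨-, -, -, -, -, -, e, he, h1, h2, h3⟩ := mem_filter.1 hx
      exact mem_biUnion.2 ⟨e, mem_filter.2 ⟨he, h1, h3⟩, h2⟩
    have h1 : #{x | GoodTriple E Δ₁ Δ₂ u x v} ≤ codeg E u v * r :=
      (card_le_card hsub).trans (card_biUnion_le_card_mul _ _ _ fun e he =>
        (hE e (mem_filter.1 he).1).le)
    calc (#{x | GoodTriple E Δ₁ Δ₂ u x v} : ℝ) ≤ codeg E u v * r := by exact_mod_cast h1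
      _ ≤ Δ₂ * r := mul_le_mul_of_nonneg_right hc (Nat.cast_nonneg _)
      _ = r * Δ₂ := mul_comm _ _
  · have : ({x | GoodTriple E Δ₁ Δ₂ u x v} : Finset V) = ∅ :=
      filter_eq_empty_iff.2 fun x _ h => hc h.2.2.1
    rw [this, card_empty, Nat.cast_zero]
    positivity

-- For fixed `x` and `v` there are at most `r * codeg E x v` choices of `u`, and the codegrees at
-- `x` sum to `r * deg E x`.
open Classical in
include hE in
theorem sum_card_goodTriple_le {Δ₁ Δ₂ : ℝ} (hΔ₁ : 0 ≤ Δ₁) (x : V) :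
    ∑ v, (#{u | GoodTriple E Δ₁ Δ₂ u x v} : ℝ) ≤ (r : ℝ) ^ 2 * Δ₁ := by
  by_cases hc : (deg E x : ℝ) ≤ Δ₁
  · have h1 : ∀ v, #{u | GoodTriple E Δ₁ Δ₂ u x v} ≤ codeg E x v * r := by
      intro v
      have hsub : ({u | GoodTriple E Δ₁ Δ₂ u x v} : Finset V) ⊆
          ({e ∈ E | x ∈ e ∧ v ∈ e} : Finset (Finset V)).biUnion id := by
        intro u hu
        obtain ⟨-, -, -, -, -, -, e, he, h1, h2, h3⟩ := mem_filter.1 hu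
        exact mem_biUnion.2 ⟨e, mem_filter.2 ⟨he, h2, h3⟩, h1⟩
      exact (card_le_card hsub).trans (card_biUnion_le_card_mul _ _ _ fun e he =>
        (hE e (mem_filter.1 he).1).le)
    have h2 : ∑ v, #{u | GoodTriple E Δ₁ Δ₂ u x v} ≤ r * deg E x * r := by
      refine (sum_le_sum fun v _ => h1 v).trans (le_of_eq ?_)
      rw [← sum_mul, sum_codeg hE]
    calc ∑ v, (#{u | GoodTriple E Δ₁ Δ₂ u x v} : ℝ) ≤ r * deg E x * r := by exact_mod_cast h2
      _ = (r : ℝ) ^ 2 * deg E x := by ring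
      _ ≤ _ := mul_le_mul_of_nonneg_left hc (sq_nonneg _)
  · have : ∀ v, ({u | GoodTriple E Δ₁ Δ₂ u x v} : Finset V) = ∅ := fun v =>
      filter_eq_empty_iff.2 fun u _ h => hc h.2.1
    simp only [this, card_empty, Nat.cast_zero, sum_const_zero]
    positivity

open Classical in
include hE in
/-- Every edge contains a bad pair or a good triple. -/
theorem card_le_badPair_add_goodTriple (hr : 4 ≤ r) (Δ₁ Δ₂ : ℝ) :
    #E ≤ #{e ∈ E | ∃ u ∈ e, ∃ x ∈ e, BadPair E Δ₁ Δ₂ u x} +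
      #{e ∈ E | ∃ u ∈ e, ∃ x ∈ e, ∃ v ∈ e, GoodTriple E Δ₁ Δ₂ u x v} := by
  rw [← card_filter_add_card_filter_not (s := E)
    (p := fun e => ∃ u ∈ e, ∃ x ∈ e, BadPair E Δ₁ Δ₂ u x)]
  refine Nat.add_le_add_left (card_le_card fun e he => ?_) _
  obtain ⟨heE, hno⟩ := mem_filter.1 he
  push Not at hno
  refine mem_filter.2 ⟨heE, ?_⟩
  have hcard := hE e heE
  have hheavy : #{v ∈ e | Δ₁ < deg E v} ≤ 1 := by
    rw [card_le_one]
    intro a ha b hb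
    rw [mem_filter] at ha hb
    by_contra hab
    exact hno a ha.1 b hb.1 ⟨hab, Or.inl ⟨ha.2, hb.2⟩⟩
  -- This is where `r ≥ 4` enters: one vertex may be heavy and three light ones must remain.
  have hlight : 2 < #{v ∈ e | ¬ Δ₁ < deg E v} := by
    have := card_filter_add_card_filter_not (s := e) (p := fun v => Δ₁ < (deg E v : ℝ))
    omega
  obtain ⟨u, x, v, hu, hx, hv, hux, huv, hxv⟩ := two_lt_card_iff.1 hlight
  rw [mem_filter, not_lt] at hu hx hv
  have hpair : ∀ a b, a ∈ e ∧ (deg E a : ℝ) ≤ Δ₁ → b ∈ e ∧ (deg E b : ℝ) ≤ Δ₁ → a ≠ b →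
      (codeg E a b : ℝ) ≤ Δ₂ := by
    intro a b ha hb hab
    by_contra h
    exact hno a ha.1 b hb.1 ⟨hab, Or.inr ⟨ha.2, hb.2, not_le.1 h⟩⟩
  exact ⟨u, hu.1, x, hx.1, v, hv.1, ⟨hux, huv.symm, hxv.symm⟩, hx.2, hpair u v hu hv huv, hu.2,
    hpair x v hx hv hxv, e, heE, hu.1, hx.1, hv.1⟩

open Classical in
include hE in
/-- In a linear hypergraph few edges contain two vertices of large degree. -/
theorem card_badPair_edges_le (hlin : ∀ u x, u ≠ x → codeg E u x ≤ 1) {Δ₁ : ℝ} (hΔ₁ : 0 < Δ₁) :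
    (#{e ∈ E | ∃ u ∈ e, ∃ x ∈ e, BadPair E Δ₁ 1 u x} : ℝ) ≤ (r * #E / Δ₁) ^ 2 := by
  set S : Finset V := {v | Δ₁ < deg E v} with hS
  have h3 := card_mul_le_sum (deg E) (a := Δ₁)
  rw [sum_deg hE, ← le_div_iff₀ hΔ₁] at h3
  push_cast at h3
  have hbad : ∀ u x, BadPair E Δ₁ 1 u x → u ≠ x ∧ u ∈ S ∧ x ∈ S := by
    rintro u x ⟨hne, h | h⟩
    · exact ⟨hne, by simp [hS, h.1], by simp [hS, h.2]⟩
    · have : (codeg E u x : ℝ) ≤ 1 := by exact_mod_cast hlin u x hne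
      exact absurd h.2.2 this.not_gt
  -- By linearity each pair of distinct heavy vertices lies in at most one edge.
  have h4 : #{e ∈ E | ∃ u ∈ e, ∃ x ∈ e, BadPair E Δ₁ 1 u x} ≤ #(S ×ˢ S) := by
    have hsub : ({e ∈ E | ∃ u ∈ e, ∃ x ∈ e, BadPair E Δ₁ 1 u x} : Finset (Finset V)) ⊆
        (S ×ˢ S).biUnion fun p =>
          if p.1 = p.2 then ∅ else {e ∈ E | p.1 ∈ e ∧ p.2 ∈ e} := by
      intro e he
      obtain ⟨heE, u, hu, x, hx, hb⟩ := mem_filter.1 he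
      obtain ⟨hne, huS, hxS⟩ := hbad u x hb
      refine mem_biUnion.2 ⟨(u, x), mem_product.2 ⟨huS, hxS⟩, ?_⟩
      rw [if_neg hne]
      exact mem_filter.2 ⟨heE, hu, hx⟩
    refine (card_le_card hsub).trans ((card_biUnion_le_card_mul _ _ 1 fun p _ => ?_).trans
      (mul_one _).le)
    split_ifs with h
    · simp
    · exact hlin _ _ h
  calc (#{e ∈ E | ∃ u ∈ e, ∃ x ∈ e, BadPair E Δ₁ 1 u x} : ℝ) ≤ (#(S ×ˢ S) : ℝ) := by
        exact_mod_cast h4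
    _ = (#S : ℝ) ^ 2 := by rw [card_product]; push_cast; ring
    _ ≤ _ := pow_le_pow_left₀ (Nat.cast_nonneg _) h3 2

end Degrees

/-! ### Choice of thresholds and constants. -/

/-- The condition `L ≥ 2 / 3` is exactly what gives `2 * (1 + L) ≤ 5 * L`; it holds for `L = log m`
since `log 2 > 2 / 3`. -/
theorem const_mul_div_log_sq_le {a Q K s L : ℝ} (ha : 0 ≤ a) (hQ : 0 ≤ Q) (hK : 0 < K)
    (hL : 2 / 3 ≤ L) (h : a * Q / (4 * (1 + L) ^ 2) ≤ K * s) :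
    a / (25 * K) * (Q / L ^ 2) ≤ s := by
  have hL0 : 0 < L := by linarith
  have h1 : a * Q / (25 * L ^ 2) ≤ a * Q / (4 * (1 + L) ^ 2) := by
    refine div_le_div_of_nonneg_left (by positivity) (by positivity) ?_
    nlinarith
  have h2 : a / (25 * K) * (Q / L ^ 2) = a * Q / (25 * L ^ 2) / K := by
    field_simp
  rw [h2, div_le_iff₀ hK, mul_comm s]
  exact h1.trans h

theorem rpow_mul_rpow_of_add_eq {m a b c : ℝ} (hm : 0 < m) (h : a + b = c) :
    m ^ a * m ^ b = m ^ c := by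
  rw [← Real.rpow_add hm, h]

theorem two_thirds_le_log {m : ℝ} (hm : 2 ≤ m) : 2 / 3 ≤ Real.log m := by
  have h1 := Real.log_le_log (by norm_num) hm
  have h2 := Real.log_two_gt_d9
  linarith

section Bounds

variable {V : Type*} [Fintype V] [DecidableEq V] {E : Finset (Finset V)} {r k : ℕ}

-- The exponent `q` is fixed by requiring `√(D₁ D₂)` to be of order `m ^ (1 - q)`. The triple bound
-- has only `(1 + L) ^ (3/2)` in the denominator; it is weakened to `(1 + L) ^ 2`.
open Classical in
theorem surplus_of_goodTriples (hE : ∀ e ∈ E, #e = r) (hE2 : 2 ≤ #E)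
    (hV : Fintype.card V ≤ r * #E) (hr : 4 ≤ r) (hk : 3 ≤ k) (hkr : k ≤ r) (hrk : r ≤ k + 1)
    {s : ℝ} (hs : ∀ P : V → Fin k, (cutCount E P : ℝ) ≤ baseline E r k + s)
    {m : ℝ} (hm : m = #E) {Δ₁ Δ₂ D q : ℝ} (hΔ₁ : 1 ≤ Δ₁) (hΔ₂ : 1 ≤ Δ₂) (hD : 0 < D)
    (hDm : r ^ 2 * Δ₁ * (r * Δ₂) = D * m ^ (2 * (1 - q)))
    (hcard : m / 2 ≤
      (#{e ∈ E | ∃ u ∈ e, ∃ x ∈ e, ∃ v ∈ e, GoodTriple E Δ₁ Δ₂ u x v} : ℝ)) :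
    1 / (4 * (k : ℝ) ^ 2) / (k : ℝ) ^ r / (2 * √(72 * D)) /
      (25 * (1 + ((r : ℝ) ^ 2 + (r : ℝ) ^ 4) * (k : ℝ) ^ r)) * (m ^ q / Real.log m ^ 2) ≤ s := by
  have hm2 : (2 : ℝ) ≤ m := by rw [hm]; exact_mod_cast hE2
  have hm0 : 0 < m := by linarith
  have hr0 : (4 : ℝ) ≤ r := by exact_mod_cast hr
  have hL1 := two_thirds_le_log hm2
  have hk0 : (0 : ℝ) < k := by exact_mod_cast (by omega : 0 < k)
  have h1 := surplus_of_triples (GoodTriple E Δ₁ Δ₂) E hE hE2 hV hk hkr hrk hs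
    (fun u x v h => h.swap) (fun u x v h => h.1) (D₁ := r ^ 2 * Δ₁) (D₂ := r * Δ₂)
    (by nlinarith) (by nlinarith) (card_goodTriple_le hE (by linarith))
    (sum_card_goodTriple_le hE (by linarith))
  rw [← hm, hDm] at h1
  have hκ0 : 0 < 1 / (4 * (k : ℝ) ^ 2) / (k : ℝ) ^ r := by positivity
  generalize 1 / (4 * (k : ℝ) ^ 2) / (k : ℝ) ^ r = κ at *
  generalize Real.log m = L at *
  have hL0 : 0 < L := by linarith
  refine const_mul_div_log_sq_le (by positivity) (by positivity) (by positivity) hL1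
    (le_trans ?_ h1)
  have h2 : √(72 * (1 + L) * (D * m ^ (2 * (1 - q)))) ≤ √(72 * D) * m ^ (1 - q) * (1 + L) := by
    refine Real.sqrt_le_iff.2 ⟨by positivity, ?_⟩
    rw [mul_pow, mul_pow, Real.sq_sqrt (by positivity), ← Real.rpow_natCast (m ^ (1 - q)),
      ← Real.rpow_mul hm0.le]
    have h3 : (1 - q) * ((2 : ℕ) : ℝ) = 2 * (1 - q) := by push_cast; ring
    rw [h3]
    have h4 : 0 ≤ D * m ^ (2 * (1 - q)) := by positivity
    have h5 : 1 + L ≤ (1 + L) ^ 2 := by nlinarith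
    nlinarith [mul_le_mul_of_nonneg_left h5 h4]
  have h6 : κ / (2 * √(72 * D)) * m ^ q / (4 * (1 + L) ^ 2) =
      m / 2 * κ / (√(72 * D) * m ^ (1 - q) * (1 + L) * (4 * (1 + L))) := by
    have h7 : m ^ q * m ^ (1 - q) = m := by
      rw [rpow_mul_rpow_of_add_eq hm0 (add_sub_cancel q 1), Real.rpow_one]
    have h8 : 0 < m ^ (1 - q) := by positivity
    have h9 : 0 < √(72 * D) := by positivity
    have h10 : m ^ q = m / m ^ (1 - q) := by rw [eq_div_iff h8.ne', h7]
    rw [h10]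
    field_simp
  rw [h6]
  exact div_le_div₀ (by positivity) (mul_le_mul_of_nonneg_right hcard hκ0.le)
    (by positivity) (mul_le_mul_of_nonneg_right h2 (by positivity))

-- These thresholds make both degree bounds for bad pairs equal to `r * m ^ (2/5)`.
open Classical in
theorem surplus_of_badPairs (hE : ∀ e ∈ E, #e = r) (hE2 : 2 ≤ #E) (hk : 3 ≤ k) (hkr : k ≤ r)
    (hrk : r ≤ k + 1) {s : ℝ}
    (hs : ∀ P : V → Fin k, (cutCount E P : ℝ) ≤ baseline E r k + s)
    {m : ℝ} (hm : m = #E) (hcard : m / 2 ≤ (#{e ∈ E | ∃ u ∈ e, ∃ x ∈ e,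
      BadPair E (m ^ (3 / 5 : ℝ)) (m ^ (1 / 5 : ℝ)) u x} : ℝ)) :
    1 / (2 * r) * (1 / 8 / (k : ℝ) ^ r) / (25 * (1 + (r : ℝ) ^ 2 * (k : ℝ) ^ r)) *
      (m ^ (3 / 5 : ℝ) / Real.log m ^ 2) ≤ s := by
  have hE0 : E.Nonempty := card_pos.1 (by omega)
  have hm2 : (2 : ℝ) ≤ m := by rw [hm]; exact_mod_cast hE2
  have hm0 : 0 < m := by linarith
  have hL1 := two_thirds_le_log hm2
  have hk0 : (0 : ℝ) < k := by exact_mod_cast (by omega : 0 < k)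
  have hr0 : (0 : ℝ) < r := by exact_mod_cast (by omega : 0 < r)
  have hm35 : m ^ (2 / 5 : ℝ) * m ^ (3 / 5 : ℝ) = m := by
    rw [rpow_mul_rpow_of_add_eq (c := 1) hm0 (by norm_num), Real.rpow_one]
  have hm25 : m ^ (2 / 5 : ℝ) * m ^ (1 / 5 : ℝ) = m ^ (3 / 5 : ℝ) :=
    rpow_mul_rpow_of_add_eq hm0 (by norm_num)
  have h2 := surplus_of_pairs E hE hE0 hk hkr hrk hs
    (BadPair E (m ^ (3 / 5 : ℝ)) (m ^ (1 / 5 : ℝ))) (fun u x h => h.symm)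
    (fun u h => h.1 rfl) (ρ := r * m ^ (2 / 5 : ℝ)) (by positivity)
    (card_badPair_le hE (by positivity) (by positivity)
      (by rw [div_le_iff₀ (by positivity), mul_assoc, hm35, hm])
      (by rw [div_le_iff₀ (by positivity), mul_assoc, hm25]))
  rw [← hm] at h2
  have hκ0 : 0 < 1 / 8 / (k : ℝ) ^ r := by positivity
  have hz : 0 < m ^ (2 / 5 : ℝ) := by positivity
  generalize 1 / 8 / (k : ℝ) ^ r = κ at *
  generalize Real.log m = L at *
  have hL0 : 0 < L := by linarith
  refine const_mul_div_log_sq_le (by positivity) (by positivity) (by positivity) hL1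
    (le_trans ?_ h2)
  have h3 : 1 / (2 * r) * κ * m ^ (3 / 5 : ℝ) = m / 2 * (1 / (r * m ^ (2 / 5 : ℝ)) * κ) := by
    have h4 : m ^ (3 / 5 : ℝ) = m / m ^ (2 / 5 : ℝ) := by
      rw [eq_div_iff hz.ne', mul_comm, hm35]
    rw [h4]
    field_simp
  rw [h3]
  refine div_le_div₀ (by positivity) (mul_le_mul_of_nonneg_right hcard (by positivity))
    (by positivity) ?_
  nlinarith

-- The threshold `2 * r * √m` leaves at most `√m / 2` heavy vertices, hence at most `m / 4` edges
-- with a bad pair; the others contain good triples.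
open Classical in
theorem surplus_of_linear (hE : ∀ e ∈ E, #e = r) (hE2 : 2 ≤ #E)
    (hV : Fintype.card V ≤ r * #E) (hr : 4 ≤ r) (hk : 3 ≤ k) (hkr : k ≤ r) (hrk : r ≤ k + 1)
    {s : ℝ} (hs : ∀ P : V → Fin k, (cutCount E P : ℝ) ≤ baseline E r k + s)
    {m : ℝ} (hm : m = #E) (hlin : ∀ u x, u ≠ x → codeg E u x ≤ 1) :
    1 / (4 * (k : ℝ) ^ 2) / (k : ℝ) ^ r / (2 * √(72 * (2 * (r : ℝ) ^ 4))) /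
      (25 * (1 + ((r : ℝ) ^ 2 + (r : ℝ) ^ 4) * (k : ℝ) ^ r)) *
        (m ^ (3 / 4 : ℝ) / Real.log m ^ 2) ≤ s := by
  have hm2 : (2 : ℝ) ≤ m := by rw [hm]; exact_mod_cast hE2
  have hm0 : 0 < m := by linarith
  have hr0 : (4 : ℝ) ≤ r := by exact_mod_cast hr
  have hsqrt1 : 1 ≤ √m := Real.one_le_sqrt.2 (by linarith)
  have hΔ : 0 < 2 * r * √m := by positivity
  have h1 := card_badPair_edges_le hE hlin hΔ
  have h2 : (r * m / (2 * r * √m)) ^ 2 = m / 4 := by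
    rw [div_pow, mul_pow, mul_pow, mul_pow, Real.sq_sqrt hm0.le]
    field_simp
    norm_num
  rw [← hm, h2] at h1
  have hsplit := card_le_badPair_add_goodTriple hE hr (2 * r * √m) 1
  have hsplit' : m ≤ (#{e ∈ E | ∃ u ∈ e, ∃ x ∈ e, BadPair E (2 * r * √m) 1 u x} : ℝ) +
      (#{e ∈ E | ∃ u ∈ e, ∃ x ∈ e, ∃ v ∈ e, GoodTriple E (2 * r * √m) 1 u x v} : ℝ) := by
    conv_lhs => rw [hm]
    exact_mod_cast hsplit
  have h3 : m ^ (2 * (1 - 3 / 4) : ℝ) = √m := by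
    rw [Real.sqrt_eq_rpow]
    congr 1
    norm_num
  refine surplus_of_goodTriples hE hE2 hV hr hk hkr hrk hs hm (Δ₁ := 2 * r * √m) (Δ₂ := 1)
    (by nlinarith) le_rfl (by positivity) ?_ (by linarith)
  rw [h3]
  ring

end Bounds

theorem exists_surplus_const (r k : ℕ) (hr : 4 ≤ r) (hk : 3 ≤ k) (hkr : k ≤ r) (hrk : r ≤ k + 1) :
    ∃ c : ℝ, 0 < c ∧ ∀ (V : Type*) [Fintype V] [DecidableEq V] (E : Finset (Finset V)),
      (∀ e ∈ E, #e = r) → 2 ≤ #E → Fintype.card V ≤ r * #E → ∀ s : ℝ,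
      (∀ P : V → Fin k, (cutCount E P : ℝ) ≤ baseline E r k + s) → ∀ m : ℝ, m = #E →
        c * (m ^ (3 / 5 : ℝ) / Real.log m ^ 2) ≤ s ∧
        ((∀ u x, u ≠ x → codeg E u x ≤ 1) →
          c * (m ^ (3 / 4 : ℝ) / Real.log m ^ 2) ≤ s) := by
  have hr0 : (0 : ℝ) < r := by exact_mod_cast (by omega : 0 < r)
  have hk0 : (0 : ℝ) < k := by exact_mod_cast (by omega : 0 < k)
  refine ⟨min (1 / (2 * r) * (1 / 8 / (k : ℝ) ^ r) / (25 * (1 + (r : ℝ) ^ 2 * (k : ℝ) ^ r)))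
    (min (1 / (4 * (k : ℝ) ^ 2) / (k : ℝ) ^ r / (2 * √(72 * (r : ℝ) ^ 3)) /
      (25 * (1 + ((r : ℝ) ^ 2 + (r : ℝ) ^ 4) * (k : ℝ) ^ r)))
    (1 / (4 * (k : ℝ) ^ 2) / (k : ℝ) ^ r / (2 * √(72 * (2 * (r : ℝ) ^ 4))) /
      (25 * (1 + ((r : ℝ) ^ 2 + (r : ℝ) ^ 4) * (k : ℝ) ^ r)))),
    lt_min (by positivity) (lt_min (by positivity) (by positivity)), ?_⟩
  intro V _ _ E hE hE2 hV s hs m hm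
  classical
  have hm2 : (2 : ℝ) ≤ m := by rw [hm]; exact_mod_cast hE2
  have hm0 : 0 < m := by linarith
  have hQ0 : ∀ q : ℝ, 0 ≤ m ^ q / Real.log m ^ 2 := fun q => by positivity
  constructor
  · have hsplit := card_le_badPair_add_goodTriple hE hr (m ^ (3 / 5 : ℝ)) (m ^ (1 / 5 : ℝ))
    have hsplit' : m ≤ (#{e ∈ E | ∃ u ∈ e, ∃ x ∈ e,
          BadPair E (m ^ (3 / 5 : ℝ)) (m ^ (1 / 5 : ℝ)) u x} : ℝ) +
        (#{e ∈ E | ∃ u ∈ e, ∃ x ∈ e, ∃ v ∈ e,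
          GoodTriple E (m ^ (3 / 5 : ℝ)) (m ^ (1 / 5 : ℝ)) u x v} : ℝ) := by
      conv_lhs => rw [hm]
      exact_mod_cast hsplit
    have h1 : (1 : ℝ) ≤ m := by linarith
    rcases le_or_gt (m / 2) (#{e ∈ E | ∃ u ∈ e, ∃ x ∈ e,
      BadPair E (m ^ (3 / 5 : ℝ)) (m ^ (1 / 5 : ℝ)) u x} : ℝ) with h | h
    · exact le_trans (mul_le_mul_of_nonneg_right (min_le_left _ _) (hQ0 _))
        (surplus_of_badPairs hE hE2 hk hkr hrk hs hm h)
    · refine le_trans (mul_le_mul_of_nonneg_right ((min_le_right _ _).trans (min_le_left _ _))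
        (hQ0 _)) (surplus_of_goodTriples hE hE2 hV hr hk hkr hrk hs hm
          (Δ₁ := m ^ (3 / 5 : ℝ)) (Δ₂ := m ^ (1 / 5 : ℝ))
          (Real.one_le_rpow h1 (by norm_num)) (Real.one_le_rpow h1 (by norm_num)) (by positivity)
          ?_ (by linarith))
      rw [← rpow_mul_rpow_of_add_eq (a := 3 / 5) (b := 1 / 5) (c := 2 * (1 - 3 / 5)) hm0
        (by norm_num)]
      ring
  · intro hlin
    exact le_trans (mul_le_mul_of_nonneg_right ((min_le_right _ _).trans (min_le_right _ _))
      (hQ0 _)) (surplus_of_linear hE hE2 hV hr hk hkr hrk hs hm hlin)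

/-! ### Passage from `Hypergraph` to finsets and conclusion. -/

/-- A finite uniform hypergraph, as a finset of finsets on the type of its covered vertices. -/
theorem exists_finset_model {α : Type*} (H : Hypergraph α) (hE : H.edgeSet.Finite) {r : ℕ}
    (hU : H.IsUniform r) {k : ℕ} (hk : 1 ≤ k) :
    ∃ (U : Set α) (_ : Fintype U) (_ : DecidableEq U) (E : Finset (Finset U)),
      (∀ e ∈ E, #e = r) ∧ #E = H.edgeSet.ncard ∧ Fintype.card U ≤ r * #E ∧
      (∀ P : U → Fin k, cutCount E P ≤ H.maxCut k) ∧
      (H.IsLinear → ∀ u x, u ≠ x → codeg E u x ≤ 1) := by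
  classical
  have : NeZero k := ⟨by omega⟩
  have hfin : ∀ e ∈ H.edgeSet, e.Finite := fun e he =>
    Set.finite_of_encard_eq_coe (hU e he)
  -- Keeping only covered vertices gives at most `r * #E` of them, which bounds the dimension in the
  -- trace moment argument.
  set U : Set α := ⋃₀ H.edgeSet with hUdef
  have hUfin : U.Finite := hE.sUnion hfin
  let inst : Fintype U := hUfin.fintype
  let f : Set α → Finset U := fun e => {v : U | v.1 ∈ e}
  have hf : ∀ (e : Set α) (v : U), v ∈ f e ↔ v.1 ∈ e := fun e v => by simp [f]
  have himg : ∀ e ∈ H.edgeSet, Subtype.val '' (f e : Set U) = e := by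
    intro e he
    ext a
    constructor
    · rintro ⟨v, hv, rfl⟩
      exact (hf e v).1 hv
    · intro ha
      exact ⟨⟨a, e, he, ha⟩, (hf e _).2 ha, rfl⟩
  have hinj : Set.InjOn f H.edgeSet := by
    intro e he e' he' h
    rw [← himg e he, ← himg e' he', h]
  set E : Finset (Finset U) := hE.toFinset.image f with hEdef
  have hmem : ∀ e, e ∈ E ↔ ∃ e' ∈ H.edgeSet, f e' = e := by
    intro e
    simp [hEdef]
  have hEr : ∀ e ∈ E, #e = r := by
    intro e he
    obtain ⟨e', he', rfl⟩ := (hmem e).1 he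
    have h1 := hU e' he'
    rw [← himg e' he', Subtype.val_injective.encard_image, Set.encard_coe_eq_coe_finsetCard] at h1
    exact_mod_cast h1
  have hEcard : #E = H.edgeSet.ncard := by
    rw [hEdef, card_image_of_injOn (by simpa using hinj), Set.ncard_eq_toFinset_card _ hE]
  refine ⟨U, inst, inferInstance, E, hEr, hEcard, ?_, ?_, ?_⟩
  · have h1 : (univ : Finset U) ⊆ E.biUnion id := by
      rintro ⟨a, e, he, ha⟩ -
      exact mem_biUnion.2 ⟨f e, (hmem _).2 ⟨e, he, rfl⟩, (hf e _).2 ha⟩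
    have h2 := (card_le_card h1).trans (card_biUnion_le_card_mul _ _ r fun e he => (hEr e he).le)
    rw [card_univ] at h2
    rw [mul_comm]
    exact h2
  · intro P
    -- The default value 0 off `U` is harmless, as all edges lie inside `U`.
    let P' : α → Fin k := fun a => if h : a ∈ U then P ⟨a, h⟩ else 0
    have hP' : ∀ v : U, P' v.1 = P v := fun v => by simp [P']
    refine le_trans ?_ ((H.isGreatest_maxCut hE k).2 ⟨P', rfl⟩)
    have hcutfin : (H.cutEdges P').Finite := hE.subset fun e he => he.1
    change _ ≤ (H.cutEdges P').ncard
    rw [cutCount, Set.ncard_eq_toFinset_card _ hcutfin]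
    refine le_trans (card_le_card ?_) (card_image_le (f := f))
    intro e he
    obtain ⟨heE, hcut⟩ := mem_filter.1 he
    obtain ⟨e', he', rfl⟩ := (hmem e).1 heE
    refine mem_image.2 ⟨e', hcutfin.mem_toFinset.2 ⟨he', fun i => ?_⟩, rfl⟩
    obtain ⟨v, hv, hvi⟩ := hcut i
    exact ⟨v.1, (hf e' v).1 hv, by rw [hP', hvi]⟩
  · intro hlin u x hux
    rw [codeg, card_le_one]
    intro a ha b hb
    rw [mem_filter] at ha hb
    obtain ⟨a', ha', rfl⟩ := (hmem a).1 ha.1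
    obtain ⟨b', hb', rfl⟩ := (hmem b).1 hb.1
    by_contra hab
    have h1 := hlin a' ha' b' hb' fun h => hab (by rw [h])
    rw [Set.encard_le_one_iff] at h1
    refine hux (Subtype.ext (h1 u.1 x.1 ?_ ?_))
    · exact ⟨(hf _ _).1 ha.2.1, (hf _ _).1 hb.2.1⟩
    · exact ⟨(hf _ _).1 ha.2.2, (hf _ _).1 hb.2.2⟩

end Hypergraph

open Hypergraph in
theorem theorem1p4 (r : ℕ) (hr : 4 ≤ r) :
    ∃ c : ℝ, 0 < c ∧
      ∀ k : ℕ, (k = r - 1 ∨ k = r) →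
        ∀ (α : Type*) (H : Hypergraph α), H.vertexSet.Finite → H.IsUniform r →
          ∀ m : ℕ, H.edgeSet.ncard = m → 2 ≤ m →
            c * ((m : ℝ) ^ (3 / 5 : ℝ) / (Real.log m) ^ 2) ≤ H.surplus r k ∧
            (H.IsLinear →
              c * ((m : ℝ) ^ (3 / 4 : ℝ) / (Real.log m) ^ 2) ≤ H.surplus r k) := by
  obtain ⟨c₁, hc₁, h₁⟩ := exists_surplus_const r (r - 1) hr (by omega) (by omega) (by omega)
  obtain ⟨c₂, hc₂, h₂⟩ := exists_surplus_const r r hr (by omega) (by omega) (by omega)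
  refine ⟨min c₁ c₂, lt_min hc₁ hc₂, ?_⟩
  intro k hk α H _ hU m hm hm2
  -- An infinite set has `ncard` equal to 0, so `2 ≤ m` already forces finiteness.
  have hE : H.edgeSet.Finite := Set.finite_of_ncard_pos (by omega)
  obtain ⟨U, _, _, E, hEr, hEcard, hUcard, hcut, hlin⟩ :=
    H.exists_finset_model hE hU (k := k) (by omega)
  have hs : ∀ P : U → Fin k, (cutCount E P : ℝ) ≤ baseline E r k + H.surplus r k := by
    intro P
    have h1 : (cutCount E P : ℝ) ≤ H.maxCut k := by exact_mod_cast hcut P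
    rw [surplus, baseline, hEcard]
    linarith
  have hmE : (m : ℝ) = #E := by rw [hEcard, hm]
  have hQ0 : ∀ q : ℝ, 0 ≤ (m : ℝ) ^ q / Real.log m ^ 2 := fun q => by positivity
  rcases hk with rfl | rfl
  · obtain ⟨h3, h4⟩ := h₁ U E hEr (by omega) hUcard _ hs m hmE
    exact ⟨(mul_le_mul_of_nonneg_right (min_le_left _ _) (hQ0 _)).trans h3, fun hl =>
      (mul_le_mul_of_nonneg_right (min_le_left _ _) (hQ0 _)).trans (h4 (hlin hl))⟩
  · obtain ⟨h3, h4⟩ := h₂ U E hEr (by omega) hUcard _ hs m hmE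
    exact ⟨(mul_le_mul_of_nonneg_right (min_le_right _ _) (hQ0 _)).trans h3, fun hl =>
      (mul_le_mul_of_nonneg_right (min_le_right _ _) (hQ0 _)).trans (h4 (hlin hl))⟩
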